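/- Let $Q=[-\tfrac12,\tfrac12]$ and let $d,m\ge 1$ be integers. There is a constant $C=C(d,m)>0$, depending only on $d$ and $m$, such that the following holds. For $k\in\mathbb Z^d$ put $\omega_{\mathrm{hc}}(k)=\prod_{j=1}^d\max(1,|k_j|)$, and let $I_N^d=\{k\in\mathbb Z^d:\omega_{\mathrm{hc}}(k)\le N\}$ with $N\in\mathbb N$, $N\ge 2^{d+1}$. Let $z\in\mathbb Z^d$ and $M\in\mathbb N$, $M\ge1$, be such that the rank-1 lattice with nodes $x_j=\frac jM z \bmod 1\in[-\tfrac12,\tfrac12)^d$, $j=0,\dots,M-1$, is reconstructing for $I_N^d$: $(k_1-k_2)\cdot z\not\equiv 0 \pmod M$ for all distinct $k_1,k_2\in I_N^d$. Let $\omega(y)=\prod_{j=1}^d\omega_j(y_j)$ with integrable $\omega_j:Q\to[0,\infty)$. Let $\psi(x)=(\psi_1(x_1),\dots,\psi_d(x_d))$, where each $\psi_j:Q\to Q$ is a torus-to-cube transformation: $\psi_j$ is strictly increasing and continuously differentiable, $\psi_j(\pm\frac12)=\pm\frac12$, $\psi_j'(-\frac12)=\psi_j'(\frac12)$, and $\psi_j^{-1}$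 is continuously differentiable on $(-\frac12,\frac12)$. Put $\varrho_j(y)=1/\psi_j'(\psi_j^{-1}(y))$ and $\varrho(y)=\prod_j\varrho_j(y_j)$, with the conventions that $\omega_j(y)/\varrho_j(y)=0$ where $\psi_j'(\psi_j^{-1}(y))=0$ and $\sqrt{\varrho_j(y)/\omega_j(y)}=0$ where $\omega_j(y)=0$. Let $$\varphi_k(y)=\prod_{j=1}^d\sqrt{\frac{\varrho_j(y_j)}{\omega_j(y_j)}}\;e^{2\pi i k_j\psi_j^{-1}(y_j)},\qquad k\in\mathbb Z^d .$$ Let $C_{\mathrm{mix}}^m(Q^d)$ be the space of functions on $Q^d$ all of whose partial derivatives $D^{\alpha}$ with $\alpha\in\mathbb N_0^d$, $\max_j\alpha_j\le m$, exist and are continuous on the closed cube $Q^d$. Assume that $\psi\in C_{\mathrm{mix}}^m(Q^d)$ and that, for all such $\alpha$, the derivative $D^{\alpha}\bigl[\prod_{j=1}^d\sqrt{(\omega_j\circ\psi_j)\,\psi_j'}\bigr]$ exists, is continuous on $Q^d$ and vanishes on the boundary of $Q^d$. Let $h:Q^d\to\mathbb C$ be in $L_2(Q^d,\omega)\cap C_{\mathrm{mix}}^m(Q^d)$,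 where $L_2(Q^d,\omega)$ consists of the $h\in L_2(Q^d)$ with $\|h\|_{L_2(Q^d,\omega)}^2=\int_{Q^d}|h|^2\,\omega\,dy<\infty$. With $\hat h_k=\int_{Q^d}h\,\overline{\varphi_k}\,\omega\,dy$ and $y_j=\psi(x_j)$ put $$\|h\|_{\mathcal H^m(Q^d)}=\Bigl(\sum_{k\in\mathbb Z^d}\omega_{\mathrm{hc}}(k)^{2m}|\hat h_k|^2\Bigr)^{1/2},\qquad \hat h_k^\Lambda=\frac1M\sum_{j=0}^{M-1}h(y_j)\sqrt{\frac{\omega(y_j)}{\varrho(y_j)}}\;e^{-2\pi i k\cdot\psi^{-1}(y_j)},\qquad S^\Lambda_{I_N^d}h=\sum_{k\in I_N^d}\hat h_k^\Lambda\,\varphi_k .$$ Then $\|h\|_{\mathcal H^m(Q^d)}<\infty$, and $$\bigl\|h-S^\Lambda_{I_N^d}h\bigr\|_{L_2(Q^d,\omega)}\le C\,N^{-m}(\log N)^{(d-1)/2}\,\|h\|_{\mathcal H^m(Q^d)} .$$ -/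

import Mathlib

namespace CubeApprox

noncomputable section

/-- The interval `[-1/2, 1/2]`. -/
def I₀ : Set ℝ := Set.Icc (-(1 / 2)) (1 / 2)

/-- The cube `[-1/2, 1/2]^d`. -/
def cube (d : ℕ) : Set (Fin d → ℝ) := Set.univ.pi fun _ => I₀

/-- The boundary points `[-1/2, 1/2]^d \ (-1/2, 1/2)^d`. -/
def cubeBoundary (d : ℕ) : Set (Fin d → ℝ) :=
  cube d \ Set.univ.pi fun _ => Set.Ioo (-(1 / 2)) (1 / 2)

/-! ### Mixed smoothness on the closed cube -/

/-- `D α` is the mixed partial derivative `D^α F` on the closed cube (one-sided at the boundary),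
for all multi-indices `α` with `max α_j ≤ m`. On the cube, `D α` is determined by `F`. -/
structure IsMixedDeriv {d : ℕ} {E : Type*} [NormedAddCommGroup E] [NormedSpace ℝ E] (m : ℕ)
    (F : (Fin d → ℝ) → E) (D : (Fin d → ℕ) → (Fin d → ℝ) → E) : Prop where
  zero : ∀ x ∈ cube d, D 0 x = F x
  succ : ∀ α : Fin d → ℕ, (∀ i, α i ≤ m) → ∀ j, α j < m → ∀ x ∈ cube d,
    HasDerivWithinAt (fun t => D α (Function.update x j t)) (D (α + Pi.single j 1) x) I₀ (x j)

/-- `F ∈ C_mix^m([-1/2, 1/2]^d)`: all `D^α F` with `max α_j ≤ m` exist and are continuous on the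
closed cube (which is compact, so that they are bounded). -/
def CMix {d : ℕ} {E : Type*} [NormedAddCommGroup E] [NormedSpace ℝ E] (m : ℕ)
    (F : (Fin d → ℝ) → E) : Prop :=
  ∃ D : (Fin d → ℕ) → (Fin d → ℝ) → E, IsMixedDeriv m F D ∧
    ∀ α : Fin d → ℕ, (∀ i, α i ≤ m) → ContinuousOn (D α) (cube d)

/-- `D^α F ∈ C_0([-1/2, 1/2]^d)` for all `α` with `max α_j ≤ m`: these derivatives exist, are
continuous on the closed cube and vanish at its boundary points. -/
def CMixZero {d : ℕ} {E : Type*} [NormedAddCommGroup E] [NormedSpace ℝ E] (m : ℕ)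
    (F : (Fin d → ℝ) → E) : Prop :=
  ∃ D : (Fin d → ℕ) → (Fin d → ℝ) → E, IsMixedDeriv m F D ∧
    ∀ α : Fin d → ℕ, (∀ i, α i ≤ m) →
      ContinuousOn (D α) (cube d) ∧ ∀ x ∈ cubeBoundary d, D α x = 0

/-! ### Torus-to-cube transformations -/

/-- The derivative of `ψ` on `[-1/2, 1/2]` (one-sided at the end points). -/
def der (ψ : ℝ → ℝ) (x : ℝ) : ℝ := derivWithin ψ I₀ x

/-- The inverse of `ψ : [-1/2, 1/2] → [-1/2, 1/2]`. -/
def inv (ψ : ℝ → ℝ) : ℝ → ℝ := Function.invFunOn ψ I₀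

/-- `ψ` is a (univariate) torus-to-cube transformation. -/
structure IsTorusToCube (ψ : ℝ → ℝ) : Prop where
  left : ψ (-(1 / 2)) = -(1 / 2)
  right : ψ (1 / 2) = 1 / 2
  contDiffOn : ContDiffOn ℝ 1 ψ I₀
  strictMonoOn : StrictMonoOn ψ I₀
  der_periodic : der ψ (-(1 / 2)) = der ψ (1 / 2)
  inv_contDiffOn : ContDiffOn ℝ 1 (inv ψ) (Set.Ioo (-(1 / 2)) (1 / 2))

/-- The density `ϱ(y) = (ψ⁻¹)'(y) = 1 / ψ'(ψ⁻¹(y))`. (If `ψ'` vanishes at `±1/2`, then `ϱ` is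
infinite there; the value `0` in that case yields `ω / ϱ = 0`, as it should be.) -/
def density (ψ : ℝ → ℝ) (y : ℝ) : ℝ := 1 / der ψ (inv ψ y)

variable {d : ℕ}

/-- The multivariate transformation `ψ(x) = (ψ_1(x_1), …, ψ_d(x_d))`. -/
def mapCube (ψ : Fin d → ℝ → ℝ) (x : Fin d → ℝ) : Fin d → ℝ := fun j => ψ j (x j)

/-- The product `∏_j u_j(y_j)`, used for the weight `ω` and the density `ϱ`. -/
def prodFun (u : Fin d → ℝ → ℝ) (y : Fin d → ℝ) : ℝ := ∏ j, u j (y j)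

/-- The function `x ↦ ∏_j √(ω_j(ψ_j(x_j)) ψ_j'(x_j))`. -/
def sqrtWeight (ω ψ : Fin d → ℝ → ℝ) (x : Fin d → ℝ) : ℝ :=
  ∏ j, Real.sqrt (ω j (ψ j (x j)) * der (ψ j) (x j))

/-- `ω(y) = ∏_j ω_j(y_j)` with integrable `ω_j : [-1/2, 1/2] → [0, ∞)`. -/
def IsWeight (ω : Fin d → ℝ → ℝ) : Prop :=
  ∀ j, (∀ y ∈ I₀, 0 ≤ ω j y) ∧ MeasureTheory.IntegrableOn (ω j) I₀

/-! ### Weighted `L_2` spaces on the cube -/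

/-- `|h|² ω` is integrable over the cube. -/
def FiniteWeightedNorm (ω : Fin d → ℝ → ℝ) (h : (Fin d → ℝ) → ℂ) : Prop :=
  MeasureTheory.IntegrableOn (fun y => ‖h y‖ ^ 2 * prodFun ω y) (cube d)

/-- `h ∈ L_2([-1/2, 1/2]^d, ω)`. -/
def MemWeightedL2 (ω : Fin d → ℝ → ℝ) (h : (Fin d → ℝ) → ℂ) : Prop :=
  MeasureTheory.MemLp h 2 (MeasureTheory.volume.restrict (cube d)) ∧ FiniteWeightedNorm ω h

/-- The norm of `L_2([-1/2, 1/2]^d, ω)`. -/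
def weightedNorm (ω : Fin d → ℝ → ℝ) (h : (Fin d → ℝ) → ℂ) : ℝ :=
  Real.sqrt (∫ y in cube d, ‖h y‖ ^ 2 * prodFun ω y)

/-- The scalar product of `L_2([-1/2, 1/2]^d, ω)`. -/
def weightedInner (ω : Fin d → ℝ → ℝ) (h₁ h₂ : (Fin d → ℝ) → ℂ) : ℂ :=
  ∫ y in cube d, h₁ y * (starRingEnd ℂ) (h₂ y) * (prodFun ω y : ℂ)

/-- `φ_k(y) = √(ϱ(y) / ω(y)) e^{2πi k ψ⁻¹(y)}` (univariate). -/
def phi₁ (ω ψ : ℝ → ℝ) (k : ℤ) (y : ℝ) : ℂ :=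
  (Real.sqrt (density ψ y / ω y) : ℂ) * Complex.exp (2 * Real.pi * Complex.I * k * inv ψ y)

/-- `φ_k(y) = ∏_j φ_{k_j}(y_j)`. -/
def phi (ω ψ : Fin d → ℝ → ℝ) (k : Fin d → ℤ) (y : Fin d → ℝ) : ℂ :=
  ∏ j, phi₁ (ω j) (ψ j) (k j) (y j)

/-- The Fourier coefficient `ĥ_k = (h, φ_k)`. -/
def fourierCoef (ω ψ : Fin d → ℝ → ℝ) (h : (Fin d → ℝ) → ℂ) (k : Fin d → ℤ) : ℂ :=
  weightedInner ω h (phi ω ψ k)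

/-- `ω_hc(k) = ∏_j max(1, |k_j|)`. -/
def hcWeight (k : Fin d → ℤ) : ℤ := ∏ j, max 1 |k j|

/-- `h ∈ H^m([-1/2, 1/2]^d)`. -/
def MemH (m : ℕ) (ω ψ : Fin d → ℝ → ℝ) (h : (Fin d → ℝ) → ℂ) : Prop :=
  MemWeightedL2 ω h ∧
    Summable fun k : Fin d → ℤ => (hcWeight k : ℝ) ^ (2 * m) * ‖fourierCoef ω ψ h k‖ ^ 2

/-- The norm of `H^m([-1/2, 1/2]^d)`. -/
def normH (m : ℕ) (ω ψ : Fin d → ℝ → ℝ) (h : (Fin d → ℝ) → ℂ) : ℝ :=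
  Real.sqrt (∑' k : Fin d → ℤ, (hcWeight k : ℝ) ^ (2 * m) * ‖fourierCoef ω ψ h k‖ ^ 2)

/-! ### Hyperbolic crosses, rank-1 lattices, and the lattice approximation -/

/-- The hyperbolic cross `I_N^d = {k ∈ ℤ^d : ω_hc(k) ≤ N}`, see `mem_hyperbolicCross`. -/
def hyperbolicCross (d N : ℕ) : Finset (Fin d → ℤ) :=
  (Fintype.piFinset fun _ : Fin d => Finset.Icc (-(N : ℤ)) N).filter fun k => hcWeight k ≤ N

theorem mem_hyperbolicCross {N : ℕ} {k : Fin d → ℤ} :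
    k ∈ hyperbolicCross d N ↔ hcWeight k ≤ N := by
  rw [hyperbolicCross, Finset.mem_filter, and_iff_right_iff_imp]
  intro hk
  rw [Fintype.mem_piFinset]
  intro j
  rw [Finset.mem_Icc, ← abs_le]
  have h1 : ∀ i, (1 : ℤ) ≤ max 1 |k i| := fun i => le_max_left _ _
  refine ((le_max_right 1 |k j|).trans ?_).trans hk
  have h2 := Finset.prod_le_prod_of_subset_of_one_le' (f := fun i => (max 1 |k i|).toNat)
    (Finset.subset_univ {j}) (fun i _ _ => by have := h1 i; omega)
  rw [Finset.prod_singleton] at h2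
  have h3 : ((∏ i, (max 1 |k i|).toNat : ℕ) : ℤ) = hcWeight k := by
    rw [hcWeight, Nat.cast_prod]
    exact Finset.prod_congr rfl fun i _ => Int.toNat_of_nonneg (zero_le_one.trans (h1 i))
  rw [← h3, ← Int.toNat_of_nonneg (zero_le_one.trans (h1 j))]
  exact_mod_cast h2

/-- The lattice node `x_j = (j / M) z mod 1`, represented in `[-1/2, 1/2)^d`. -/
def node (z : Fin d → ℤ) (M j : ℕ) : Fin d → ℝ :=
  fun i => Int.fract ((j : ℝ) / M * z i + 1 / 2) - 1 / 2

/-- The rank-1 lattice `Λ(z, M)` is a reconstructing one for `I`: `t · z ≢ 0 (mod M)` for all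
nonzero `t` in the difference set of `I`. -/
def IsReconstructing (z : Fin d → ℤ) (M : ℕ) (I : Finset (Fin d → ℤ)) : Prop :=
  ∀ k₁ ∈ I, ∀ k₂ ∈ I, k₁ - k₂ ≠ 0 → ¬ (∑ i, (k₁ - k₂) i * z i ≡ 0 [ZMOD M])

/-- The approximated Fourier coefficient
`ĥ_k^Λ = 1/M ∑_{j<M} h(y_j) √(ω(y_j) / ϱ(y_j)) e^{-2πi k·ψ⁻¹(y_j)}` with `y_j = ψ(x_j)`. -/
def latticeCoef (ω ψ : Fin d → ℝ → ℝ) (z : Fin d → ℤ) (M : ℕ) (h : (Fin d → ℝ) → ℂ)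
    (k : Fin d → ℤ) : ℂ :=
  1 / (M : ℂ) * ∑ j ∈ Finset.range M,
    let y := mapCube ψ (node z M j)
    h y * (Real.sqrt (prodFun ω y / prodFun (fun i => density (ψ i)) y) : ℂ) *
      Complex.exp (-(2 * Real.pi * Complex.I * ∑ i, (k i : ℂ) * inv (ψ i) (y i)))

/-- The approximated Fourier partial sum `S_I^Λ h = ∑_{k ∈ I} ĥ_k^Λ φ_k`. -/
def latticeSum (ω ψ : Fin d → ℝ → ℝ) (z : Fin d → ℤ) (M : ℕ) (I : Finset (Fin d → ℤ))
    (h : (Fin d → ℝ) → ℂ) (y : Fin d → ℝ) : ℂ :=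
  ∑ k ∈ I, latticeCoef ω ψ z M h k * phi ω ψ k y

end

end CubeApprox

open CubeApprox

/-!
The substitution `y = ψ(x)` turns `h` into `f = (h ∘ ψ) ∏_j √((ω_j ∘ ψ_j) ψ_j')` (`transformed`)
and, where the weight is positive, `φ_k` with the same factor into the character `e^{2πi k·x}`. It preserves the Fourier coefficients
(`fourierCoef_eq_cubeCoef`) and the lattice rule (`latticeCoef_eq_torusLatticeCoef`), and the
weighted error for `h` is at most the `L_2` error for `f` (`weighted_error_le`; it may be smaller,
because the functions `φ_k` vanish where the weight does, while the characters do not).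

*Finiteness of the norm.* By the Leibniz and chain rules all mixed derivatives of `f` up to order
`m` in each variable are continuous and vanish on the boundary (`HasMixedDerivs.mul`,
`HasMixedDerivs.comp_mapCube`). Hence `f` descends to a continuous function on the torus
(`exists_torus_lift`), integration by parts produces no boundary terms, and Bessel's inequality
for the derivatives gives `∑_k ω_hc(k)^{2m} |f̂_k|² < ∞` (`summable_hcWeight_mul_cubeCoef`).

*The error.* The Fourier series of `f` then converges absolutely, so that the lattice rule at `k`
is the sum of `f̂_l` over the class `k + Λ^⊥` of the dual lattice (`hasSum_torusLatticeCoef`). The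
squared error splits into the truncation error, at most `N^{-2m}` times the squared norm, and the
aliasing error. By the Cauchy-Schwarz inequality the latter is at most the squared norm times the
supremum over `k ∈ I_N` of `∑ ω_hc(l)^{-2m}` over `l ≠ k` in `k + Λ^⊥`; the classes of different
`k ∈ I_N` are disjoint (`integral_norm_sub_lattice_sq_le`).

The sum over a class is the heart of the matter. The lattice is reconstructing exactly if the
translates `l + I_N` of the points `l` of a class are disjoint. All `l ≠ k` lie outside `I_N`, and
`l + I_N` contains a box of at least `N / 2` points with weights between `ω_hc(l)` and
`2^d ω_hc(l)`. For `m = 1` the sum over the class is therefore `O(1 / N)` times the sum of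
`ω_hc^{-2}` over the whole complement of `I_N` (`sum_class_hcWeight_inv_sq_le`), which is
`O(N^{-1} (log N)^{d-1})` (`sum_hcWeight_inv_sq_le`). For larger `m` a factor `N^{-(2m-2)}` is split
off, because `ω_hc > N` outside `I_N`.
-/

namespace CubeApprox

open UnitAddTorus MeasureTheory

-- Fourier series on the torus are taken with respect to the normalized Haar measure
attribute [local instance] instMeasureSpaceUnitAddCircle
  instIsAddHaarMeasureUnitAddCircleVolume instIsProbabilityMeasureUnitAddCircleVolume

variable {d : ℕ}

/-! ### Sums over hyperbolic crosses -/

theorem one_le_hcWeight (k : Fin d → ℤ) : 1 ≤ hcWeight k :=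
  Finset.prod_induction _ (1 ≤ ·) (fun _ _ ha hb => one_le_mul_of_one_le_of_one_le ha hb) le_rfl
    fun _ _ => le_max_left _ _

/-- A sum of an even function over integers is controlled by twice the sums over positive integers
and the term at zero. -/
theorem sum_int_natAbs_le (s : Finset ℤ) (g : ℕ → ℝ) (B : ℝ)
    (hB : ∀ t : Finset ℕ, (∀ n ∈ t, ∃ r ∈ s, r ≠ 0 ∧ n = r.natAbs) → ∑ n ∈ t, g n ≤ B) :
    ∑ r ∈ s, g r.natAbs ≤ 2 * B + if (0 : ℤ) ∈ s then g 0 else 0 := by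
  have hsplit : ∑ r ∈ s, g r.natAbs = ∑ r ∈ s with 0 < r, g r.natAbs +
      (∑ r ∈ s with r < 0, g r.natAbs + ∑ r ∈ s with r = 0, g r.natAbs) := by
    rw [← Finset.sum_filter_add_sum_filter_not s (fun r => 0 < r)]
    congr 1
    rw [← Finset.sum_filter_add_sum_filter_not (s.filter fun r => ¬ 0 < r) (fun r => r < 0),
      Finset.filter_filter, Finset.filter_filter]
    congr 1 <;> congr 1 <;> ext r <;> simp <;> omega
  have h1 : ∑ r ∈ s with 0 < r, g r.natAbs ≤ B := by
    rw [← Finset.sum_image (f := g) (g := Int.natAbs)]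
    · refine hB _ fun n hn => ?_
      obtain ⟨r, hr, rfl⟩ := Finset.mem_image.1 hn
      rw [Finset.mem_filter] at hr
      exact ⟨r, hr.1, hr.2.ne', rfl⟩
    · intro a ha b hb hab
      simp only [Finset.coe_filter, Set.mem_ofPred_eq] at ha hb
      omega
  have h2 : ∑ r ∈ s with r < 0, g r.natAbs ≤ B := by
    rw [← Finset.sum_image (f := g) (g := Int.natAbs)]
    · refine hB _ fun n hn => ?_
      obtain ⟨r, hr, rfl⟩ := Finset.mem_image.1 hn
      rw [Finset.mem_filter] at hr
      exact ⟨r, hr.1, hr.2.ne, rfl⟩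
    · intro a ha b hb hab
      simp only [Finset.coe_filter, Set.mem_ofPred_eq] at ha hb
      omega
  have h3 : ∑ r ∈ s with r = 0, g r.natAbs = if (0 : ℤ) ∈ s then g 0 else 0 := by
    rw [Finset.filter_eq']
    split_ifs <;> simp
  linarith

/-- The univariate tail `∑_{max(1, |r|) > X} max(1, |r|)^{-2}` is at most `5 min(1, 1/X)`. -/
theorem sum_max_one_abs_inv_sq_le (s : Finset ℤ) {X : ℝ} (hX : 0 < X)
    (hs : ∀ r ∈ s, X < ((max 1 |r| : ℤ) : ℝ)) :
    ∑ r ∈ s, (((max 1 |r| : ℤ) : ℝ) ^ 2)⁻¹ ≤ 5 * min 1 X⁻¹ := by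
  have key := sum_int_natAbs_le s (fun n => (((max 1 n : ℕ) : ℝ) ^ 2)⁻¹) (2 / (⌊X⌋₊ + 1))
    (fun t ht => by
      obtain ⟨K, hK⟩ := t.exists_nat_subset_range
      refine le_trans ?_ (sum_Ioo_inv_sq_le ⌊X⌋₊ K)
      have hpos : ∀ n ∈ t, 1 ≤ n := fun n hn => by
        obtain ⟨r, -, hr0, rfl⟩ := ht n hn
        omega
      refine le_trans (le_of_eq (Finset.sum_congr rfl fun n hn => ?_))
        (Finset.sum_le_sum_of_subset_of_nonneg (s := t) ?_ fun _ _ _ => by positivity)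
      · rw [max_eq_right (hpos n hn)]
      · intro n hn
        rw [Finset.mem_Ioo]
        refine ⟨?_, Finset.mem_range.1 (hK hn)⟩
        obtain ⟨r, hr, hr0, rfl⟩ := ht n hn
        have h := hs r hr
        rw [max_eq_right (Int.one_le_abs hr0), Int.abs_eq_natAbs, Int.cast_natCast] at h
        exact (Nat.floor_lt hX.le).2 h)
  have hcast : ∀ r : ℤ, ((max 1 |r| : ℤ) : ℝ) = ((max 1 r.natAbs : ℕ) : ℝ) := fun r => by
    rw [Int.abs_eq_natAbs]
    norm_cast
  simp_rw [hcast]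
  refine key.trans ?_
  have hfl : X < ⌊X⌋₊ + 1 := Nat.lt_floor_add_one X
  rcases lt_or_ge X 1 with h1 | h1
  · rw [min_eq_left (one_le_inv₀ hX |>.2 h1.le), Nat.floor_eq_zero.2 h1]
    split_ifs <;> norm_num
  · rw [min_eq_right (inv_le_one_of_one_le₀ h1), if_neg]
    · have : 2 / ((⌊X⌋₊ : ℝ) + 1) ≤ 2 * X⁻¹ := by
        rw [div_eq_mul_inv]
        gcongr
      have h0 : 0 < X⁻¹ := by positivity
      linarith
    · intro h0
      have := hs 0 h0
      simp at this
      linarith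

/-- The partial sums of `ζ(1 + ε)` against the telescoping sum of `(n^{-ε} - (n+1)^{-ε}) / ε`, the
integrals of `x^{-1-ε}` over the intervals `[n, n+1]`. -/
theorem sum_Icc_rpow_le {ε : ℝ} (hε : 0 < ε) (K : ℕ) :
    ∑ n ∈ Finset.Icc 1 (K + 1), (n : ℝ) ^ (-1 - ε) ≤ 1 + (1 - ((K + 1 : ℕ) : ℝ) ^ (-ε)) / ε := by
  induction K with
  | zero => simp
  | succ K ih =>
    rw [Finset.sum_Icc_succ_top (by omega)]
    set a : ℝ := ((K + 1 : ℕ) : ℝ) with ha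
    have ha0 : 0 < a := by rw [ha]; positivity
    have hb : ((K + 1 + 1 : ℕ) : ℝ) = a + 1 := by rw [ha]; push_cast; ring
    rw [hb]
    have hstep : (a + 1) ^ (-1 - ε) * ε ≤ a ^ (-ε) - (a + 1) ^ (-ε) := by
      have h1 : 1 + ε / (a + 1) ≤ ((a + 1) / a) ^ ε := by
        rw [Real.rpow_def_of_pos (by positivity)]
        have h2 := Real.one_sub_inv_le_log_of_pos (x := (a + 1) / a) (by positivity)
        have h3 : 1 - ((a + 1) / a)⁻¹ = 1 / (a + 1) := by field_simp; ring
        rw [h3] at h2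
        have h4 := Real.add_one_le_exp (Real.log ((a + 1) / a) * ε)
        have h5 : ε / (a + 1) = 1 / (a + 1) * ε := by ring
        rw [h5]
        nlinarith
      have h2 : a ^ (-ε) = (a + 1) ^ (-ε) * ((a + 1) / a) ^ ε := by
        rw [Real.div_rpow (by positivity) ha0.le, Real.rpow_neg ha0.le,
          Real.rpow_neg (by positivity : (0 : ℝ) ≤ a + 1)]
        have : 0 < (a + 1) ^ ε := by positivity
        field_simp
      have h3 : (a + 1) ^ (-1 - ε) = (a + 1) ^ (-ε) * (a + 1)⁻¹ := by
        rw [show -1 - ε = -ε + -1 by ring, Real.rpow_add (by positivity), Real.rpow_neg_one]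
      rw [h2, h3]
      have h4 : 0 < (a + 1) ^ (-ε) := by positivity
      have h5 : ε / (a + 1) = (a + 1)⁻¹ * ε := by ring
      rw [h5] at h1
      nlinarith
    have hstep' := (le_div_iff₀ hε).2 hstep
    have : (1 - (a + 1) ^ (-ε)) / ε
        = (1 - a ^ (-ε)) / ε + (a ^ (-ε) - (a + 1) ^ (-ε)) / ε := by ring
    linarith

theorem sum_max_one_abs_rpow_le (s : Finset ℤ) {ε : ℝ} (hε : 0 < ε) (hε1 : ε ≤ 1) :
    ∑ r ∈ s, ((max 1 |r| : ℤ) : ℝ) ^ (-1 - ε) ≤ 5 / ε := by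
  have key := sum_int_natAbs_le s (fun n => ((max 1 n : ℕ) : ℝ) ^ (-1 - ε)) (1 + 1 / ε)
    (fun t ht => by
      obtain ⟨K, hK⟩ := t.exists_nat_subset_range
      have h1 := sum_Icc_rpow_le hε K
      have h2 : (1 - ((K + 1 : ℕ) : ℝ) ^ (-ε)) / ε ≤ 1 / ε := by
        gcongr
        linarith [Real.rpow_nonneg (Nat.cast_nonneg' (K + 1) : (0 : ℝ) ≤ ((K + 1 : ℕ) : ℝ)) (-ε)]
      refine le_trans ?_ (h1.trans (by linarith))
      have hpos : ∀ n ∈ t, 1 ≤ n := fun n hn => by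
        obtain ⟨r, -, hr0, rfl⟩ := ht n hn
        omega
      refine le_trans (le_of_eq (Finset.sum_congr rfl fun n hn => ?_))
        (Finset.sum_le_sum_of_subset_of_nonneg (s := t) ?_ fun _ _ _ => by positivity)
      · rw [max_eq_right (hpos n hn)]
      · intro n hn
        have := Finset.mem_range.1 (hK hn)
        rw [Finset.mem_Icc]
        exact ⟨hpos n hn, by omega⟩)
  have hcast : ∀ r : ℤ, ((max 1 |r| : ℤ) : ℝ) = ((max 1 r.natAbs : ℕ) : ℝ) := fun r => by
    rw [Int.abs_eq_natAbs]
    norm_cast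
  simp_rw [hcast]
  refine key.trans ?_
  have h0 : 1 ≤ 1 / ε := one_le_one_div hε hε1
  have h1 : 5 / ε = 5 * (1 / ε) := by ring
  rw [h1]
  split_ifs <;> simp <;> simp at h0 <;> linarith

theorem sum_hcWeight_rpow_le (s : Finset (Fin d → ℤ)) {ε : ℝ} (hε : 0 < ε) (hε1 : ε ≤ 1) :
    ∑ k ∈ s, (hcWeight k : ℝ) ^ (-1 - ε) ≤ (5 / ε) ^ d := by
  have hsub : s ⊆ Fintype.piFinset fun j => s.image fun k => k j := fun k hk =>
    Fintype.mem_piFinset.2 fun j => Finset.mem_image_of_mem _ hk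
  refine (Finset.sum_le_sum_of_subset_of_nonneg hsub fun k _ _ => ?_).trans ?_
  · have := one_le_hcWeight k
    positivity
  have hprod : ∀ k : Fin d → ℤ,
      (hcWeight k : ℝ) ^ (-1 - ε) = ∏ j, ((max 1 |k j| : ℤ) : ℝ) ^ (-1 - ε) := fun k => by
    rw [hcWeight, Int.cast_prod, ← Real.finsetProd_rpow]
    intro j _
    positivity
  simp_rw [hprod]
  rw [← Finset.prod_univ_sum (fun j => s.image fun k => k j)
    (fun _ (r : ℤ) => ((max 1 |r| : ℤ) : ℝ) ^ (-1 - ε))]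
  refine (Finset.prod_le_prod (fun j _ => Finset.sum_nonneg fun r _ => by positivity)
    fun j _ => sum_max_one_abs_rpow_le _ hε hε1).trans ?_
  simp [div_pow]

theorem hcWeight_succ (k : Fin (d + 1) → ℤ) :
    hcWeight k = max 1 |k 0| * hcWeight (Fin.tail k) := by
  rw [hcWeight, Fin.prod_univ_succ]
  rfl

/-- The tail outside the hyperbolic cross:
`∑_{ω_hc(k) > N} ω_hc(k)^{-2} = O(N^{-1} (log N)^{d-1})`. The first coordinate is summed exactly,
which saves one logarithm; Rankin's trick with exponent `1 / log N` takes care of the others. -/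
theorem sum_hcWeight_inv_sq_le (s : Finset (Fin (d + 1) → ℤ)) {N : ℝ} (hN : 1 ≤ Real.log N)
    (hN0 : 0 < N) (hs : ∀ k ∈ s, N < hcWeight k) :
    ∑ k ∈ s, ((hcWeight k : ℝ) ^ 2)⁻¹ ≤ 5 * Real.exp 1 * 5 ^ d * Real.log N ^ d / N := by
  have hlog : 0 < Real.log N := by linarith
  set ε : ℝ := 1 / Real.log N with hεdef
  have hε : 0 < ε := by positivity
  have hε1 : ε ≤ 1 := by
    rw [hεdef, div_le_one hlog]
    exact hN
  have hNε : N ^ ε = Real.exp 1 := by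
    rw [Real.rpow_def_of_pos hN0, hεdef, mul_one_div_cancel hlog.ne']
  rw [← Finset.sum_fiberwise_of_maps_to (t := s.image Fin.tail) (g := Fin.tail)
    fun k hk => Finset.mem_image_of_mem _ hk]
  have hfib : ∀ q ∈ s.image Fin.tail, ∑ k ∈ s with Fin.tail k = q, ((hcWeight k : ℝ) ^ 2)⁻¹
      ≤ 5 * Real.exp 1 / N * (hcWeight q : ℝ) ^ (-1 - ε) := by
    intro q _
    have hq : (1 : ℝ) ≤ hcWeight q := by exact_mod_cast one_le_hcWeight q
    have hq0 : (0 : ℝ) < hcWeight q := by linarith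
    have h1 : ∑ k ∈ s with Fin.tail k = q, ((hcWeight k : ℝ) ^ 2)⁻¹ =
        ((hcWeight q : ℝ) ^ 2)⁻¹ *
          ∑ r ∈ (s.filter fun k => Fin.tail k = q).image (fun k => k 0),
            (((max 1 |r| : ℤ) : ℝ) ^ 2)⁻¹ := by
      rw [Finset.sum_image, Finset.mul_sum]
      · refine Finset.sum_congr rfl fun k hk => ?_
        rw [hcWeight_succ, (Finset.mem_filter.1 hk).2, Int.cast_mul, mul_pow, mul_inv, mul_comm]
      · intro k hk k' hk' h
        simp only [Finset.coe_filter, Set.mem_ofPred_eq] at hk hk'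
        rw [← Fin.cons_self_tail k, ← Fin.cons_self_tail k', hk.2, hk'.2]
        rw [show k 0 = k' 0 from h]
    have h2 := sum_max_one_abs_inv_sq_le ((s.filter fun k => Fin.tail k = q).image (fun k => k 0))
      (X := N / hcWeight q) (by positivity) (by
        intro r hr
        obtain ⟨k, hk, rfl⟩ := Finset.mem_image.1 hr
        rw [Finset.mem_filter] at hk
        have h := hs k hk.1
        rw [hcWeight_succ, hk.2, Int.cast_mul] at h
        rwa [div_lt_iff₀ hq0])
    rw [inv_div] at h2
    -- Rankin's trick: `min 1 t ≤ t^{1-ε}`, where `N^ε = e` is harmless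
    have h3 : min 1 ((hcWeight q : ℝ) / N) ≤ ((hcWeight q : ℝ) / N) ^ (1 - ε) := by
      rcases le_total ((hcWeight q : ℝ) / N) 1 with h | h
      · refine (min_le_right _ _).trans ?_
        exact Real.self_le_rpow_of_le_one (by positivity) h (by linarith)
      · exact (min_le_left _ _).trans (Real.one_le_rpow h (by linarith))
    have h4 : ((hcWeight q : ℝ) ^ 2)⁻¹ * ((hcWeight q : ℝ) / N) ^ (1 - ε) =
        Real.exp 1 / N * (hcWeight q : ℝ) ^ (-1 - ε) := by
      rw [Real.div_rpow hq0.le hN0.le, Real.rpow_sub hN0, Real.rpow_one, hNε,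
        ← Real.rpow_natCast, ← Real.rpow_neg hq0.le, mul_div_assoc', ← Real.rpow_add hq0,
        show (-((2 : ℕ) : ℝ) + (1 - ε)) = -1 - ε by push_cast; ring]
      field_simp
    rw [h1]
    calc _ ≤ ((hcWeight q : ℝ) ^ 2)⁻¹ * (5 * ((hcWeight q : ℝ) / N) ^ (1 - ε)) := by
          gcongr
          linarith
      _ = 5 * Real.exp 1 / N * (hcWeight q : ℝ) ^ (-1 - ε) := by
          rw [mul_left_comm, h4]
          ring
  refine (Finset.sum_le_sum hfib).trans ?_
  rw [← Finset.mul_sum]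
  calc _ ≤ 5 * Real.exp 1 / N * (5 / ε) ^ d := by
        gcongr
        exact sum_hcWeight_rpow_le _ hε hε1
    _ = _ := by
        rw [hεdef, div_div_eq_mul_div, div_one, mul_pow]
        ring

/-! ### Counting in residue classes of the dual lattice -/

/-- A box with at least `N` lattice points contains a box with between `N / 2` and `N` of them. -/
theorem exists_subbox {ι : Type*} [Fintype ι] [DecidableEq ι] (b : ι → ℕ) (hb : ∀ j, 1 ≤ b j)
    {N : ℕ} (hN : 1 ≤ N) (hNb : N ≤ ∏ j, b j) :
    ∃ a : ι → ℕ, (∀ j, 1 ≤ a j ∧ a j ≤ b j) ∧ ∏ j, a j ≤ N ∧ N ≤ 2 * ∏ j, a j := by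
  set S := (Fintype.piFinset fun j => Finset.Icc 1 (b j)).filter fun a => ∏ j, a j ≤ N with hS
  have hmem : ∀ a : ι → ℕ, a ∈ S ↔ (∀ j, 1 ≤ a j ∧ a j ≤ b j) ∧ ∏ j, a j ≤ N := fun a => by
    simp [hS, Fintype.mem_piFinset]
  have hne : S.Nonempty := ⟨fun _ => 1, (hmem _).2 ⟨fun j => ⟨le_rfl, hb j⟩, by simpa using hN⟩⟩
  obtain ⟨a, haS, hmax⟩ := S.exists_max_image (fun a => ∏ j, a j) hne
  have ha := (hmem a).1 haS
  refine ⟨a, ha.1, ha.2, ?_⟩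
  by_cases hab : a = b
  · rw [hab]
    omega
  · obtain ⟨j, hj⟩ := Function.ne_iff.1 hab
    have hjlt : a j < b j := lt_of_le_of_ne (ha.1 j).2 hj
    -- raising a single side that is still too short must leave the admissible range
    have hprod : ∏ i, Function.update a j (a j + 1) i =
        (a j + 1) * ∏ i ∈ Finset.univ.erase j, a i := by
      rw [← Finset.mul_prod_erase _ _ (Finset.mem_univ j), Function.update_self]
      congr 1
      exact Finset.prod_congr rfl fun i hi => Function.update_of_ne (Finset.ne_of_mem_erase hi) _ _
    have hprod' : ∏ i, a i = a j * ∏ i ∈ Finset.univ.erase j, a i :=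
      (Finset.mul_prod_erase _ _ (Finset.mem_univ j)).symm
    have hE : 1 ≤ ∏ i ∈ Finset.univ.erase j, a i :=
      Finset.prod_induction _ (1 ≤ ·) (fun _ _ ha hb => one_le_mul_of_one_le_of_one_le ha hb) le_rfl
        fun i _ => (ha.1 i).1
    have hnot : ¬ ∏ i, Function.update a j (a j + 1) i ≤ N := by
      intro hle
      have hm := hmax _ ((hmem _).2 ⟨fun i => ?_, hle⟩)
      · rw [hprod, hprod'] at hm
        nlinarith
      · rcases eq_or_ne i j with rfl | hij
        · rw [Function.update_self]
          omega
        · rw [Function.update_of_ne hij]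
          exact ha.1 i
    rw [hprod] at hnot
    have := (ha.1 j).1
    rw [hprod']
    nlinarith

/-- The box `[p_j, p_j + a_j)` (or `(p_j - a_j, p_j]` if `p_j < 0`), which extends from `p` away
from the coordinate hyperplanes. -/
noncomputable def outwardBox (p : Fin d → ℤ) (a : Fin d → ℕ) : Finset (Fin d → ℤ) :=
  Fintype.piFinset fun j =>
    if p j < 0 then Finset.Ioc (p j - a j) (p j) else Finset.Ico (p j) (p j + a j)

theorem card_outwardBox (p : Fin d → ℤ) (a : Fin d → ℕ) : (outwardBox p a).card = ∏ j, a j := by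
  rw [outwardBox, Fintype.card_piFinset]
  refine Finset.prod_congr rfl fun j _ => ?_
  split_ifs <;> simp

theorem mem_outwardBox {p q : Fin d → ℤ} {a : Fin d → ℕ} (hq : q ∈ outwardBox p a) (j : Fin d) :
    |p j| ≤ |q j| ∧ |q j| < |p j| + a j ∧ |p j - q j| < a j := by
  have h := Fintype.mem_piFinset.1 hq j
  split_ifs at h with hp
  · rw [Finset.mem_Ioc] at h
    rw [abs_of_neg hp, abs_of_neg (by omega : q j < 0), abs_of_nonneg (by omega)]
    omega
  · rw [Finset.mem_Ico] at h
    rw [abs_of_nonneg (not_lt.1 hp), abs_of_nonneg (by omega : 0 ≤ q j), abs_of_nonpos (by omega)]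
    omega

/-- In a residue class modulo the dual lattice of a reconstructing lattice, the points outside the
hyperbolic cross have density about `1 / N`: each point `p` owns a box of at least `N / 2` points
in `p + I_N` with comparable weights, and the translates `p + I_N` are disjoint. -/
theorem sum_class_hcWeight_inv_sq_le (z : Fin (d + 1) → ℤ) (M N : ℕ) (hN0 : 0 < N)
    (hN : 1 ≤ Real.log N)
    (hrec : IsReconstructing z M (hyperbolicCross (d + 1) N)) (P : Finset (Fin (d + 1) → ℤ))
    (hP : ∀ p ∈ P, (N : ℤ) < hcWeight p)
    (hclass : ∀ p ∈ P, ∀ p' ∈ P, ∑ i, (p - p') i * z i ≡ 0 [ZMOD M]) :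
    ∑ p ∈ P, ((hcWeight p : ℝ) ^ 2)⁻¹ ≤
      2 * 4 ^ (d + 1) * (5 * Real.exp 1 * 5 ^ d) * Real.log N ^ d / (N : ℝ) ^ 2 := by
  have hN0' : (0 : ℝ) < N := by exact_mod_cast hN0
  have hbox : ∀ p : Fin (d + 1) → ℤ, ∃ B : Finset (Fin (d + 1) → ℤ), p ∈ P →
      N ≤ 2 * B.card ∧ ∀ q ∈ B, hcWeight p ≤ hcWeight q ∧
        hcWeight q ≤ 2 ^ (d + 1) * hcWeight p ∧ p - q ∈ hyperbolicCross (d + 1) N := by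
    intro p
    by_cases hp : p ∈ P
    swap
    · exact ⟨∅, fun h => absurd h hp⟩
    have hcast : ((∏ j, max 1 (p j).natAbs : ℕ) : ℤ) = hcWeight p := by
      rw [hcWeight, Nat.cast_prod]
      refine Finset.prod_congr rfl fun j _ => ?_
      rw [Int.abs_eq_natAbs]
      norm_cast
    obtain ⟨a, ha, haN, hNa⟩ := exists_subbox (fun j => max 1 (p j).natAbs)
      (fun j => le_max_left _ _) (N := N) hN0 (by
        have := hP p hp
        rw [← hcast] at this
        exact_mod_cast this.le)
    refine ⟨outwardBox p a, fun _ => ⟨by rwa [card_outwardBox], fun q hq => ⟨?_, ?_, ?_⟩⟩⟩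
    · exact Finset.prod_le_prod (fun j _ => zero_le_one.trans (le_max_left _ _)) fun j _ =>
        max_le_max le_rfl (mem_outwardBox hq j).1
    · rw [hcWeight, hcWeight]
      have : (2 : ℤ) ^ (d + 1) * ∏ j, max 1 |p j| = ∏ j, 2 * max 1 |p j| := by
        rw [Finset.prod_mul_distrib]
        simp
      rw [this]
      refine Finset.prod_le_prod (fun j _ => zero_le_one.trans (le_max_left _ _)) fun j _ => ?_
      have h1 := mem_outwardBox hq j
      have h2 := (ha j).2
      have h3 : (a j : ℤ) ≤ max 1 |p j| := by
        rw [Int.abs_eq_natAbs]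
        exact_mod_cast h2
      omega
    · rw [mem_hyperbolicCross, hcWeight]
      refine le_trans (b := ((∏ j, a j : ℕ) : ℤ)) ?_ (by exact_mod_cast haN)
      rw [Nat.cast_prod]
      refine Finset.prod_le_prod (fun j _ => zero_le_one.trans (le_max_left _ _)) fun j _ => ?_
      have h1 := (mem_outwardBox hq j).2.2
      have h2 := (ha j).1
      rw [Pi.sub_apply]
      omega
  choose B hB using hbox
  have hdisj : (P : Set (Fin (d + 1) → ℤ)).PairwiseDisjoint B := by
    intro p hp p' hp' hne
    rw [Function.onFun, Finset.disjoint_left]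
    intro q hq hq'
    have h := hrec _ ((hB p hp).2 q hq).2.2 _ ((hB p' hp').2 q hq').2.2
    rw [sub_sub_sub_cancel_right] at h
    exact h (sub_ne_zero.2 hne) (hclass p hp p' hp')
  have hpoint : ∀ p ∈ P, ((hcWeight p : ℝ) ^ 2)⁻¹ ≤
      2 * 4 ^ (d + 1) / N * ∑ q ∈ B p, ((hcWeight q : ℝ) ^ 2)⁻¹ := by
    intro p hp
    have hp1 : (1 : ℝ) ≤ hcWeight p := by exact_mod_cast one_le_hcWeight p
    have h1 : ∀ q ∈ B p, ((4 : ℝ) ^ (d + 1))⁻¹ * ((hcWeight p : ℝ) ^ 2)⁻¹ ≤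
        ((hcWeight q : ℝ) ^ 2)⁻¹ := by
      intro q hq
      have hq1 : (1 : ℝ) ≤ hcWeight q := by exact_mod_cast one_le_hcWeight q
      have h2 : (hcWeight q : ℝ) ≤ 2 ^ (d + 1) * hcWeight p := by
        exact_mod_cast ((hB p hp).2 q hq).2.1
      rw [← mul_inv]
      refine inv_anti₀ (by positivity) ?_
      calc (hcWeight q : ℝ) ^ 2 ≤ (2 ^ (d + 1) * hcWeight p) ^ 2 := by gcongr
        _ = 4 ^ (d + 1) * (hcWeight p : ℝ) ^ 2 := by
          rw [mul_pow, ← pow_mul, mul_comm (d + 1) 2, pow_mul]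
          norm_num
    have h2 := Finset.card_nsmul_le_sum _ _ _ h1
    rw [nsmul_eq_mul] at h2
    have h3 : (N : ℝ) ≤ 2 * (B p).card := by exact_mod_cast (hB p hp).1
    have h4 : (1 : ℝ) ≤ 2 * (B p).card / N := by rwa [le_div_iff₀ hN0', one_mul]
    calc ((hcWeight p : ℝ) ^ 2)⁻¹ ≤ 2 * (B p).card / N * ((hcWeight p : ℝ) ^ 2)⁻¹ :=
          le_mul_of_one_le_left (by positivity) h4
      _ = 2 * 4 ^ (d + 1) / N *
          ((B p).card * (((4 : ℝ) ^ (d + 1))⁻¹ * ((hcWeight p : ℝ) ^ 2)⁻¹)) := by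
          field_simp
      _ ≤ _ := by gcongr
  refine (Finset.sum_le_sum hpoint).trans ?_
  rw [← Finset.mul_sum, ← Finset.sum_biUnion hdisj]
  have htail := sum_hcWeight_inv_sq_le (P.biUnion B) hN hN0' (by
    intro q hq
    obtain ⟨p, hp, hq⟩ := Finset.mem_biUnion.1 hq
    exact_mod_cast (hP p hp).trans_le ((hB p hp).2 q hq).1)
  calc _ ≤ 2 * 4 ^ (d + 1) / N * (5 * Real.exp 1 * 5 ^ d * Real.log N ^ d / N) := by gcongr
    _ = _ := by ring

/-- The same bound for the exponent `2 m`. -/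
theorem sum_class_hcWeight_inv_pow_le (z : Fin (d + 1) → ℤ) (m M N : ℕ) (hm : 1 ≤ m) (hN0 : 0 < N)
    (hN : 1 ≤ Real.log N)
    (hrec : IsReconstructing z M (hyperbolicCross (d + 1) N)) (P : Finset (Fin (d + 1) → ℤ))
    (hP : ∀ p ∈ P, (N : ℤ) < hcWeight p)
    (hclass : ∀ p ∈ P, ∀ p' ∈ P, ∑ i, (p - p') i * z i ≡ 0 [ZMOD M]) :
    ∑ p ∈ P, ((hcWeight p : ℝ) ^ (2 * m))⁻¹ ≤
      2 * 4 ^ (d + 1) * (5 * Real.exp 1 * 5 ^ d) * Real.log N ^ d / (N : ℝ) ^ (2 * m) := by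
  have hN0' : (0 : ℝ) < N := by exact_mod_cast hN0
  obtain ⟨n, rfl⟩ := Nat.exists_eq_add_of_le hm
  have hpoint : ∀ p ∈ P, ((hcWeight p : ℝ) ^ (2 * (1 + n)))⁻¹ ≤
      ((N : ℝ) ^ (2 * n))⁻¹ * ((hcWeight p : ℝ) ^ 2)⁻¹ := by
    intro p hp
    have h1 : (N : ℝ) ≤ hcWeight p := by exact_mod_cast (hP p hp).le
    have h2 : (0 : ℝ) < hcWeight p := hN0'.trans_le h1
    rw [← mul_inv]
    refine inv_anti₀ (by positivity) ?_
    calc (N : ℝ) ^ (2 * n) * (hcWeight p : ℝ) ^ 2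
        ≤ (hcWeight p : ℝ) ^ (2 * n) * (hcWeight p : ℝ) ^ 2 := by gcongr
      _ = _ := by ring
  refine (Finset.sum_le_sum hpoint).trans ?_
  rw [← Finset.mul_sum]
  calc _ ≤ ((N : ℝ) ^ (2 * n))⁻¹ *
        (2 * 4 ^ (d + 1) * (5 * Real.exp 1 * 5 ^ d) * Real.log N ^ d / (N : ℝ) ^ 2) := by
        gcongr
        exact sum_class_hcWeight_inv_sq_le z M N hN0 hN hrec P hP hclass
    _ = _ := by
        have : (N : ℝ) ^ (2 * (1 + n)) = (N : ℝ) ^ (2 * n) * (N : ℝ) ^ 2 := by ring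
        rw [this]
        field_simp

/-! ### Aliasing of lattice sampling on the torus -/

/-- **Parseval's identity** for continuous functions on the torus. -/
theorem hasSum_sq_mFourierCoeff_continuousMap (F : C(UnitAddTorus (Fin d), ℂ)) :
    HasSum (fun k => ‖mFourierCoeff F k‖ ^ 2) (∫ t, ‖F t‖ ^ 2) := by
  have h := hasSum_sq_mFourierCoeff (ContinuousMap.toLp 2 MeasureTheory.volume ℂ F)
  simp_rw [mFourierCoeff_toLp] at h
  convert h using 1
  refine MeasureTheory.integral_congr_ae ?_
  filter_upwards [ContinuousMap.coeFn_toLp (𝕜 := ℂ) (p := 2) MeasureTheory.volume F] with t ht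
  rw [ht]

theorem mFourierCoeff_sub_sum (F : C(UnitAddTorus (Fin d), ℂ)) (I : Finset (Fin d → ℤ))
    (c : (Fin d → ℤ) → ℂ) (k : Fin d → ℤ) :
    mFourierCoeff (F - ∑ l ∈ I, c l • mFourier l : C(UnitAddTorus (Fin d), ℂ)) k =
      mFourierCoeff F k - if k ∈ I then c k else 0 := by
  rw [← mFourierCoeff_toLp, ← mFourierCoeff_toLp, ← mFourierBasis_repr, ← mFourierBasis_repr,
    map_sub, map_sum, map_sub, map_sum]
  simp_rw [map_smul]
  have h : ∀ l : Fin d → ℤ, (mFourierBasis (d := Fin d)).repr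
      (ContinuousMap.toLp 2 MeasureTheory.volume ℂ (mFourier l)) = lp.single 2 l 1 := fun l => by
    rw [← (mFourierBasis (d := Fin d)).repr_self l, coe_mFourierBasis]
  simp_rw [h]
  rw [lp.coeFn_sub, lp.coeFn_sum, Pi.sub_apply, Finset.sum_apply]
  congr 1
  simp [lp.single_apply, Pi.single_apply]

/-- The lattice node `(j / M) z` as a point of the torus. -/
noncomputable def torusNode (z : Fin d → ℤ) (M j : ℕ) : UnitAddTorus (Fin d) :=
  fun i => (((j : ℝ) / M * z i : ℝ) : UnitAddCircle)

theorem mFourier_coe (k : Fin d → ℤ) (x : Fin d → ℝ) :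
    mFourier k (fun i => (x i : UnitAddCircle)) =
      Complex.exp (2 * Real.pi * Complex.I * ∑ i, (k i : ℂ) * x i) := by
  rw [mFourier, ContinuousMap.coe_mk, Finset.mul_sum, Complex.exp_sum]
  refine Finset.prod_congr rfl fun i _ => ?_
  rw [fourier_coe_apply]
  congr 1
  simp
  ring

/-- Averaging a character over the lattice detects the dual lattice. -/
theorem average_mFourier_torusNode (z : Fin d → ℤ) {M : ℕ} (hM : 0 < M) (l : Fin d → ℤ) :
    1 / (M : ℂ) * ∑ j ∈ Finset.range M, mFourier l (torusNode z M j) =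
      if ∑ i, l i * z i ≡ 0 [ZMOD M] then 1 else 0 := by
  have hM' : (M : ℂ) ≠ 0 := by exact_mod_cast hM.ne'
  have hζ := Complex.isPrimitiveRoot_exp M hM.ne'
  set ζ := Complex.exp (2 * Real.pi * Complex.I / M) with hζdef
  set n := ∑ i, l i * z i with hn
  have hterm : ∀ j : ℕ, mFourier l (torusNode z M j) = (ζ ^ n) ^ j := by
    intro j
    unfold torusNode
    rw [mFourier_coe, hζdef, ← Complex.exp_int_mul, ← Complex.exp_nat_mul, hn]
    congr 1
    push_cast
    rw [Finset.mul_sum, Finset.sum_mul, Finset.mul_sum]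
    refine Finset.sum_congr rfl fun i _ => ?_
    field_simp
  simp_rw [hterm]
  have hiff : n ≡ 0 [ZMOD M] ↔ ζ ^ n = 1 := by
    rw [Int.modEq_zero_iff_dvd, ← hζ.zpow_eq_one_iff_dvd]
  split_ifs with h
  · rw [hiff.1 h]
    simp [hM']
  · have hpow : (ζ ^ n) ^ M = 1 := by
      rw [← zpow_natCast, ← zpow_mul, mul_comm, zpow_mul, zpow_natCast, hζ.pow_eq_one, one_zpow]
    have := geom_sum_mul (ζ ^ n) M
    rw [hpow, sub_self] at this
    rw [(mul_eq_zero.1 this).resolve_right (sub_ne_zero.2 fun h' => h (hiff.2 h')),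
      mul_zero]

theorem summable_hcWeight_inv_pow {m : ℕ} (hm : 1 ≤ m) :
    Summable fun k : Fin d → ℤ => ((hcWeight k : ℝ) ^ (2 * m))⁻¹ := by
  refine summable_of_sum_le (c := (5 / 1) ^ d) (fun k => ?_) fun s => ?_
  · have := one_le_hcWeight k
    positivity
  · refine le_trans (Finset.sum_le_sum fun k _ => ?_)
      (sum_hcWeight_rpow_le s one_pos le_rfl)
    have h1 : (1 : ℝ) ≤ hcWeight k := by exact_mod_cast one_le_hcWeight k
    rw [show (-1 - 1 : ℝ) = -((2 : ℕ) : ℝ) by norm_num, Real.rpow_neg (by linarith),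
      Real.rpow_natCast]
    exact inv_anti₀ (by positivity) (pow_le_pow_right₀ h1 (by omega))

theorem summable_of_summable_hcWeight_mul_sq {m : ℕ} (hm : 1 ≤ m) {a : (Fin d → ℤ) → ℂ}
    (ha : Summable fun k => (hcWeight k : ℝ) ^ (2 * m) * ‖a k‖ ^ 2) : Summable a := by
  refine Summable.of_norm_bounded (((summable_hcWeight_inv_pow hm).add ha)) fun k => ?_
  have h1 : (1 : ℝ) ≤ hcWeight k := by exact_mod_cast one_le_hcWeight k
  set u := (hcWeight k : ℝ) ^ m with hu
  have hu0 : 0 < u := by positivity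
  rw [mul_comm 2 m, pow_mul, ← hu]
  have h2 : u⁻¹ * (u * ‖a k‖) = ‖a k‖ := by field_simp
  have h3 : (u ^ 2)⁻¹ = u⁻¹ ^ 2 := by rw [inv_pow]
  rw [h3, ← mul_pow]
  nlinarith [two_mul_le_add_sq u⁻¹ (u * ‖a k‖), norm_nonneg (a k), sq_nonneg u⁻¹,
    sq_nonneg (u * ‖a k‖)]

/-- The rank-1 lattice rule for the Fourier coefficient of a function on the torus. -/
noncomputable def torusLatticeCoef (z : Fin d → ℤ) (M : ℕ) (F : UnitAddTorus (Fin d) → ℂ)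
    (k : Fin d → ℤ) : ℂ :=
  1 / (M : ℂ) * ∑ j ∈ Finset.range M, F (torusNode z M j) * mFourier (-k) (torusNode z M j)

/-- The aliasing formula: the lattice rule sums the Fourier coefficients over a residue class. -/
theorem hasSum_torusLatticeCoef (z : Fin d → ℤ) {M : ℕ} (hM : 0 < M)
    (F : C(UnitAddTorus (Fin d), ℂ)) (hF : Summable (mFourierCoeff F)) (k : Fin d → ℤ) :
    HasSum (fun l => if ∑ i, (l - k) i * z i ≡ 0 [ZMOD M] then mFourierCoeff F l else 0)
      (torusLatticeCoef z M F k) := by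
  have h := (hasSum_sum (s := Finset.range M) fun j _ =>
    (hasSum_mFourier_series_apply_of_summable hF (torusNode z M j)).mul_right
      (mFourier (-k) (torusNode z M j))).mul_left (1 / (M : ℂ))
  refine h.congr_fun fun l => ?_
  have h1 := average_mFourier_torusNode z hM (l - k)
  trans mFourierCoeff F l * if ∑ i, (l - k) i * z i ≡ 0 [ZMOD M] then 1 else 0
  · rw [mul_ite, mul_one, mul_zero]
  · rw [← h1, mul_left_comm, Finset.mul_sum]
    simp_rw [sub_eq_add_neg, mFourier_add, smul_eq_mul, mul_assoc]

/-- The Cauchy-Schwarz bound for the aliasing error of a single coefficient. It is taken over finite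
subsets of the residue class of `k`, where the bound `A` is available. -/
theorem norm_torusLatticeCoef_sub_sq_le (z : Fin d → ℤ) {m M : ℕ} (hM : 0 < M) {A : ℝ}
    (F : C(UnitAddTorus (Fin d), ℂ)) (hF : Summable (mFourierCoeff F))
    (hF2 : Summable fun k => (hcWeight k : ℝ) ^ (2 * m) * ‖mFourierCoeff F k‖ ^ 2)
    (k : Fin d → ℤ)
    (hA : ∀ P : Finset (Fin d → ℤ), (∀ p ∈ P, p ≠ k ∧ ∑ i, (p - k) i * z i ≡ 0 [ZMOD M]) →
      ∑ p ∈ P, ((hcWeight p : ℝ) ^ (2 * m))⁻¹ ≤ A) :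
    ‖torusLatticeCoef z M F k - mFourierCoeff F k‖ ^ 2 ≤ A * ∑' l : Fin d → ℤ,
      if l ≠ k ∧ ∑ i, (l - k) i * z i ≡ 0 [ZMOD M] then
        (hcWeight l : ℝ) ^ (2 * m) * ‖mFourierCoeff F l‖ ^ 2 else 0 := by
  classical
  set a := mFourierCoeff F with ha
  have hnn : ∀ l, 0 ≤ (hcWeight l : ℝ) ^ (2 * m) * ‖a l‖ ^ 2 := fun l => by
    have := one_le_hcWeight l
    positivity
  have hsum : HasSum (fun l => if l ≠ k ∧ ∑ i, (l - k) i * z i ≡ 0 [ZMOD M] then a l else 0)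
      (torusLatticeCoef z M F k - a k) := by
    refine ((hasSum_torusLatticeCoef z hM F hF k).sub (hasSum_ite_eq k (a k))).congr_fun
      fun l => ?_
    by_cases hl : l = k
    · subst hl
      simp [Int.ModEq.refl, ha]
    · simp [hl, ha]
  refine le_of_tendsto (hsum.norm.pow 2) (Filter.Eventually.of_forall fun s => ?_)
  rw [← Finset.sum_filter]
  set P := s.filter fun l => l ≠ k ∧ ∑ i, (l - k) i * z i ≡ 0 [ZMOD M] with hP
  have hPmem : ∀ p ∈ P, p ≠ k ∧ ∑ i, (p - k) i * z i ≡ 0 [ZMOD M] := fun p hp =>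
    (Finset.mem_filter.1 hp).2
  have hA0 : 0 ≤ A := (hA ∅ (by simp)).trans' (by simp)
  have hCS : (∑ p ∈ P, ‖a p‖) ^ 2 ≤ (∑ p ∈ P, ((hcWeight p : ℝ) ^ (2 * m))⁻¹) *
      ∑ p ∈ P, (hcWeight p : ℝ) ^ (2 * m) * ‖a p‖ ^ 2 := by
    refine Finset.sum_sq_le_sum_mul_sum_of_sq_le_mul P (fun p _ => ?_) (fun p _ => hnn p)
      fun p _ => ?_
    · have := one_le_hcWeight p
      positivity
    · have := one_le_hcWeight p
      have : (0 : ℝ) < (hcWeight p : ℝ) := by exact_mod_cast this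
      rw [inv_mul_cancel_left₀ (by positivity)]
  calc ‖∑ p ∈ P, a p‖ ^ 2 ≤ (∑ p ∈ P, ‖a p‖) ^ 2 := by
        gcongr
        exact norm_sum_le _ _
    _ ≤ _ := hCS
    _ ≤ _ := by
        refine mul_le_mul (hA P hPmem) ?_ (Finset.sum_nonneg fun p _ => hnn p) hA0
        rw [hP, Finset.sum_filter]
        refine Summable.sum_le_tsum s (fun l _ => ?_) ?_
        · split_ifs
          exacts [hnn l, le_rfl]
        · exact hF2.of_nonneg_of_le (fun l => by split_ifs; exacts [hnn l, le_rfl])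
            fun l => by split_ifs; exacts [le_rfl, hnn l]

/-- The squared `L_2` error of the lattice approximation on the torus: the truncation error is at
most `N^{-2m}` times the squared Sobolev norm, and the aliasing terms of different `k ∈ I_N` live on
disjoint residue classes. -/
theorem integral_norm_sub_lattice_sq_le (z : Fin (d + 1) → ℤ) {m M N : ℕ} (hm : 1 ≤ m)
    (hM : 0 < M) (hN0 : 0 < N) (hN : 1 ≤ Real.log N)
    (hrec : IsReconstructing z M (hyperbolicCross (d + 1) N))
    (F : C(UnitAddTorus (Fin (d + 1)), ℂ))
    (hF : Summable fun k => (hcWeight k : ℝ) ^ (2 * m) * ‖mFourierCoeff F k‖ ^ 2) :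
    ∫ t, ‖F t - ∑ k ∈ hyperbolicCross (d + 1) N, torusLatticeCoef z M F k * mFourier k t‖ ^ 2 ≤
      (2 * 4 ^ (d + 1) * (5 * Real.exp 1 * 5 ^ d) + 1) * Real.log N ^ d / (N : ℝ) ^ (2 * m) *
        ∑' k, (hcWeight k : ℝ) ^ (2 * m) * ‖mFourierCoeff F k‖ ^ 2 := by
  classical
  have hN0' : (0 : ℝ) < N := by exact_mod_cast hN0
  set I := hyperbolicCross (d + 1) N with hI
  set a := mFourierCoeff F with ha
  set c := torusLatticeCoef z M F with hc
  set u : (Fin (d + 1) → ℤ) → ℝ := fun k => (hcWeight k : ℝ) ^ (2 * m) * ‖a k‖ ^ 2 with hu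
  have hnn : ∀ l, 0 ≤ u l := fun l => by
    have := one_le_hcWeight l
    positivity
  set A : ℝ := 2 * 4 ^ (d + 1) * (5 * Real.exp 1 * 5 ^ d) * Real.log N ^ d / (N : ℝ) ^ (2 * m)
    with hA
  have hA0 : 0 ≤ A := by positivity
  have hout : ∀ k ∈ I, ∀ p, p ≠ k → ∑ i, (p - k) i * z i ≡ 0 [ZMOD M] → (N : ℤ) < hcWeight p := by
    intro k hk p hpk hp
    by_contra! hle
    exact hrec p (mem_hyperbolicCross.2 hle) k hk (sub_ne_zero.2 hpk) hp
  have hcoef : ∀ k ∈ I, ‖c k - a k‖ ^ 2 ≤ A * ∑' l,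
      if l ≠ k ∧ ∑ i, (l - k) i * z i ≡ 0 [ZMOD M] then u l else 0 := by
    intro k hk
    refine norm_torusLatticeCoef_sub_sq_le z hM F (summable_of_summable_hcWeight_mul_sq hm hF) hF k
      fun P hP => ?_
    refine sum_class_hcWeight_inv_pow_le z m M N hm hN0 hN hrec P
      (fun p hp => hout k hk p (hP p hp).1 (hP p hp).2) fun p hp p' hp' => ?_
    have h := (hP p hp).2.sub (hP p' hp').2
    rw [← Finset.sum_sub_distrib, sub_zero] at h
    convert h using 2 with i
    simp only [Pi.sub_apply]
    ring
  -- every frequency belongs to the residue class of at most one `k ∈ I`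
  have hdisj : ∑ k ∈ I, ∑' l, (if l ≠ k ∧ ∑ i, (l - k) i * z i ≡ 0 [ZMOD M] then u l else 0) ≤
      ∑' l, u l := by
    have hs : ∀ k ∈ I, Summable fun l =>
        if l ≠ k ∧ ∑ i, (l - k) i * z i ≡ 0 [ZMOD M] then u l else 0 := fun k _ =>
      hF.of_nonneg_of_le (fun l => by split_ifs; exacts [hnn l, le_rfl])
            fun l => by split_ifs; exacts [le_rfl, hnn l]
    rw [← Summable.tsum_finsetSum hs]
    refine Summable.tsum_le_tsum (fun l => ?_) (summable_sum hs) hF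
    rw [← Finset.sum_filter, Finset.sum_const, nsmul_eq_mul]
    refine mul_le_of_le_one_left (hnn l) ?_
    rw [Nat.cast_le_one, Finset.card_le_one]
    intro k hk k' hk'
    rw [Finset.mem_filter] at hk hk'
    by_contra hne
    refine hrec k hk.1 k' hk'.1 (sub_ne_zero.2 hne) ?_
    have h := hk'.2.2.sub hk.2.2
    rw [← Finset.sum_sub_distrib, sub_zero] at h
    convert h using 2 with i
    simp only [Pi.sub_apply]
    ring
  have hG := hasSum_sq_mFourierCoeff_continuousMap (F - ∑ l ∈ I, c l • mFourier l)
  have hGint : ∫ t, ‖F t - ∑ k ∈ I, c k * mFourier k t‖ ^ 2 =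
      ∑' k, ‖a k - if k ∈ I then c k else 0‖ ^ 2 := by
    simp_rw [mFourierCoeff_sub_sum] at hG
    rw [hG.tsum_eq]
    simp [ContinuousMap.sum_apply]
  rw [hGint]
  have hpoint : ∀ k, ‖a k - if k ∈ I then c k else 0‖ ^ 2 ≤
      (if k ∈ I then ‖c k - a k‖ ^ 2 else 0) + ((N : ℝ) ^ (2 * m))⁻¹ * u k := by
    intro k
    by_cases hk : k ∈ I
    · rw [if_pos hk, if_pos hk, norm_sub_rev]
      exact le_add_of_nonneg_right (mul_nonneg (by positivity) (hnn k))
    · rw [if_neg hk, if_neg hk, sub_zero, zero_add, hu]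
      have hlt : (N : ℝ) ≤ hcWeight k := by
        rw [hI, mem_hyperbolicCross, not_le] at hk
        exact_mod_cast hk.le
      rw [← mul_assoc]
      refine le_mul_of_one_le_left (by positivity) ?_
      rw [inv_mul_eq_div, le_div_iff₀ (by positivity), one_mul]
      gcongr
  have hs1 : HasSum (fun k => if k ∈ I then ‖c k - a k‖ ^ 2 else 0) (∑ k ∈ I, ‖c k - a k‖ ^ 2) := by
    rw [Finset.sum_congr rfl fun k hk => (if_pos hk).symm]
    exact hasSum_sum_of_ne_finset_zero fun k hk => if_neg hk
  have hs2 := hs1.summable.add (hF.mul_left ((N : ℝ) ^ (2 * m))⁻¹)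
  calc _ ≤ ∑' k, ((if k ∈ I then ‖c k - a k‖ ^ 2 else 0) + ((N : ℝ) ^ (2 * m))⁻¹ * u k) :=
        Summable.tsum_le_tsum hpoint
          (hs2.of_nonneg_of_le (fun k => by positivity) hpoint) hs2
    _ = ∑ k ∈ I, ‖c k - a k‖ ^ 2 + ((N : ℝ) ^ (2 * m))⁻¹ * ∑' k, u k := by
        rw [hs1.summable.tsum_add (hF.mul_left _), hs1.tsum_eq, tsum_mul_left]
    _ ≤ A * ∑' k, u k + Real.log N ^ d / (N : ℝ) ^ (2 * m) * ∑' k, u k := by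
        gcongr
        · refine (Finset.sum_le_sum hcoef).trans ?_
          rw [← Finset.mul_sum]
          gcongr
        · exact tsum_nonneg hnn
        · rw [← one_div]
          gcongr
          exact one_le_pow₀ hN
    _ = _ := by
        rw [hA]
        ring

/-! ### From the closed cube to the torus -/

theorem isCompact_cube : IsCompact (cube d) := isCompact_univ_pi fun _ => isCompact_Icc

theorem measurableSet_cube : MeasurableSet (cube d) := isCompact_cube.measurableSet

theorem cube_eq_Icc : cube d = Set.Icc (fun _ => -(1 / 2)) (fun _ => 1 / 2) :=
  Set.pi_univ_Icc _ _

/-- The open cube `(-1/2, 1/2)^d`. -/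
def openCube (d : ℕ) : Set (Fin d → ℝ) := Set.univ.pi fun _ => Set.Ioo (-(1 / 2)) (1 / 2)

theorem openCube_subset_cube : openCube d ⊆ cube d :=
  Set.pi_mono fun _ _ => Set.Ioo_subset_Icc_self

theorem openCube_ae_eq_cube : openCube d =ᵐ[volume] cube d := by
  rw [cube_eq_Icc]
  exact Measure.univ_pi_Ioo_ae_eq_Icc

theorem update_mem_cube {x : Fin d → ℝ} (hx : x ∈ cube d) (j : Fin d) {t : ℝ} (ht : t ∈ I₀) :
    Function.update x j t ∈ cube d := by
  intro i _
  rcases eq_or_ne i j with rfl | hij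
  · rwa [Function.update_self]
  · rw [Function.update_of_ne hij]
    exact hx i trivial

theorem mem_cubeBoundary {x : Fin d → ℝ} (hx : x ∈ cube d) {i : Fin d}
    (hi : x i = -(1 / 2) ∨ x i = 1 / 2) : x ∈ cubeBoundary d := by
  refine ⟨hx, fun h => ?_⟩
  have := h i trivial
  rw [Set.mem_Ioo] at this
  rcases hi with hi | hi <;> rw [hi] at this <;> linarith [this.1, this.2]

/-- The quotient map from `ℝ^d` onto the torus. -/
def torusPoint (x : Fin d → ℝ) : UnitAddTorus (Fin d) := fun i => (x i : UnitAddCircle)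

theorem continuous_torusPoint : Continuous (torusPoint (d := d)) :=
  continuous_pi fun i => (AddCircle.continuous_mk' 1).comp (continuous_apply i)

/-- The representative of a point of the torus in `(-1/2, 1/2]^d`. -/
theorem exists_mem_cube_torusPoint_eq (t : UnitAddTorus (Fin d)) :
    ∃ x ∈ cube d, torusPoint x = t := by
  refine ⟨fun i => (AddCircle.equivIoc 1 (-(1 / 2)) (t i)).1, fun i _ => ?_, ?_⟩
  · have := (AddCircle.equivIoc (1 : ℝ) (-(1 / 2)) (t i)).2
    exact ⟨this.1.le, this.2.trans (by norm_num)⟩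
  · funext i
    exact AddCircle.coe_equivIoc

/-- A continuous function on the closed cube that vanishes on the boundary descends to the torus. -/
theorem exists_torus_lift {f : (Fin d → ℝ) → ℂ} (hf : ContinuousOn f (cube d))
    (hf0 : ∀ x ∈ cubeBoundary d, f x = 0) :
    ∃ F : C(UnitAddTorus (Fin d), ℂ), ∀ x ∈ cube d, F (torusPoint x) = f x := by
  have : CompactSpace (cube d) := isCompact_iff_compactSpace.1 isCompact_cube
  let p : C(cube d, UnitAddTorus (Fin d)) :=
    ⟨fun x => torusPoint x.1, continuous_torusPoint.comp continuous_subtype_val⟩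
  let g : C(cube d, ℂ) := ⟨fun x => f x.1, hf.domRestrict⟩
  have hp : Topology.IsQuotientMap p := by
    refine IsClosedMap.isQuotientMap p.continuous.isClosedMap p.continuous fun t => ?_
    obtain ⟨x, hx, hxt⟩ := exists_mem_cube_torusPoint_eq t
    exact ⟨⟨x, hx⟩, hxt⟩
  have hg : Function.FactorsThrough g p := by
    rintro ⟨a, ha⟩ ⟨b, hb⟩ hab
    by_cases h : a = b
    · subst h
      rfl
    obtain ⟨i, hi⟩ := Function.ne_iff.1 h
    have hai := ha i trivial
    have hbi := hb i trivial
    -- two points of `[-1/2, 1/2]` that agree modulo `1` are both end points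
    have hmod : ((a i : ℝ) : UnitAddCircle) = b i := congrFun hab i
    rw [← sub_eq_zero, ← AddCircle.coe_sub, AddCircle.coe_eq_zero_iff] at hmod
    obtain ⟨n, hn⟩ := hmod
    rw [zsmul_eq_mul, mul_one] at hn
    simp only [I₀, Set.mem_Icc] at hai hbi
    have hn1 : (-1 : ℝ) ≤ n := by linarith
    have hn2 : (n : ℝ) ≤ 1 := by linarith
    have hn1' : -1 ≤ n := by exact_mod_cast hn1
    have hn2' : n ≤ 1 := by exact_mod_cast hn2
    have hbd : (a i = -(1 / 2) ∨ a i = 1 / 2) ∧ (b i = -(1 / 2) ∨ b i = 1 / 2) := by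
      have hcases : n = -1 ∨ n = 0 ∨ n = 1 := by omega
      rcases hcases with rfl | rfl | rfl
      · push_cast at hn
        exact ⟨Or.inl (by linarith), Or.inr (by linarith)⟩
      · push_cast at hn
        exact absurd (by linarith) hi
      · push_cast at hn
        exact ⟨Or.inr (by linarith), Or.inl (by linarith)⟩
    change f a = f b
    rw [hf0 a (mem_cubeBoundary ha hbd.1), hf0 b (mem_cubeBoundary hb hbd.2)]
  exact ⟨hp.lift g hg, fun x hx => DFunLike.congr_fun (hp.lift_comp g hg) ⟨x, hx⟩⟩

theorem integral_torus_eq_integral_cube {E : Type*} [NormedAddCommGroup E] [NormedSpace ℝ E]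
    (F : UnitAddTorus (Fin d) → E) : ∫ t, F t = ∫ x in cube d, F (torusPoint x) := by
  rw [integral_preimage F fun _ => -(1 / 2)]
  refine setIntegral_congr_set ?_
  rw [cube_eq_Icc]
  refine Filter.EventuallyEq.trans (Filter.Eventually.of_forall fun x => ?_)
    Measure.univ_pi_Ioc_ae_eq_Icc
  change (x ∈ {x : Fin d → ℝ | _}) = (x ∈ Set.univ.pi _)
  simp only [Set.mem_ofPred_eq, Set.mem_pi, Set.mem_univ, true_imp_iff]
  norm_num

/-- The character `e^{2πi k·x}` as a function on `ℝ^d`. -/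
noncomputable def character (k : Fin d → ℤ) (x : Fin d → ℝ) : ℂ := mFourier k (torusPoint x)

theorem character_eq_exp (k : Fin d → ℤ) (x : Fin d → ℝ) :
    character k x = Complex.exp (2 * Real.pi * Complex.I * ∑ i, (k i : ℂ) * x i) :=
  mFourier_coe k x

theorem continuous_character (k : Fin d → ℤ) : Continuous (character k) :=
  (mFourier k).continuous.comp continuous_torusPoint

theorem hasDerivAt_character_update (k : Fin d → ℤ) (x : Fin d → ℝ) (j : Fin d) :
    HasDerivAt (fun t => character k (Function.update x j t))
      (2 * Real.pi * Complex.I * k j * character k x) (x j) := by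
  have hsum : ∀ t : ℝ, ∑ i, (k i : ℂ) * (Function.update x j t i : ℝ) =
      k j * t + ∑ i ∈ Finset.univ.erase j, (k i : ℂ) * x i := fun t => by
    rw [← Finset.add_sum_erase _ _ (Finset.mem_univ j), Function.update_self]
    congr 1
    exact Finset.sum_congr rfl fun i hi => by rw [Function.update_of_ne (Finset.ne_of_mem_erase hi)]
  simp_rw [character_eq_exp, hsum]
  have h1 : HasDerivAt (fun t : ℝ => (k j : ℂ) * t + ∑ i ∈ Finset.univ.erase j, (k i : ℂ) * x i)
      (k j) (x j) := by
    simpa using ((Complex.ofRealCLM.hasDerivAt (x := x j)).const_mul (k j : ℂ)).add_const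
      (∑ i ∈ Finset.univ.erase j, (k i : ℂ) * x i)
  have h2 := (h1.const_mul (2 * Real.pi * Complex.I)).cexp
  convert h2 using 1
  rw [← Finset.add_sum_erase _ _ (Finset.mem_univ j)]
  ring

/-- The Fourier coefficient of a function on the cube. -/
noncomputable def cubeCoef (f : (Fin d → ℝ) → ℂ) (k : Fin d → ℤ) : ℂ :=
  ∫ x in cube d, character (-k) x * f x

theorem mFourierCoeff_eq_cubeCoef {f : (Fin d → ℝ) → ℂ} {F : C(UnitAddTorus (Fin d), ℂ)}
    (hF : ∀ x ∈ cube d, F (torusPoint x) = f x) (k : Fin d → ℤ) :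
    mFourierCoeff F k = cubeCoef f k := by
  rw [mFourierCoeff, integral_torus_eq_integral_cube]
  refine setIntegral_congr_fun measurableSet_cube fun x hx => ?_
  simp only [hF x hx, smul_eq_mul, character]

theorem summable_norm_cubeCoef_sq {f : (Fin d → ℝ) → ℂ} (hf : ContinuousOn f (cube d))
    (hf0 : ∀ x ∈ cubeBoundary d, f x = 0) : Summable fun k => ‖cubeCoef f k‖ ^ 2 := by
  obtain ⟨F, hF⟩ := exists_torus_lift hf hf0
  simpa only [mFourierCoeff_eq_cubeCoef hF] using (hasSum_sq_mFourierCoeff_continuousMap F).summable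

/-- The integral over the cube of a continuous partial derivative of a function that vanishes on
the boundary is zero. -/
theorem integral_cube_partial_eq_zero {g g' : (Fin d → ℝ) → ℂ} (j : Fin d)
    (hg' : ContinuousOn g' (cube d))
    (hder : ∀ x ∈ cube d, HasDerivWithinAt (fun t => g (Function.update x j t)) (g' x) I₀ (x j))
    (hg0 : ∀ x ∈ cubeBoundary d, g x = 0) : ∫ x in cube d, g' x = 0 := by
  cases d with
  | zero => exact j.elim0
  | succ n =>
    let e := MeasurableEquiv.piFinSuccAbove (fun _ : Fin (n + 1) => ℝ) j
    have he : MeasurePreserving e.symm :=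
      (volume_preserving_piFinSuccAbove (fun _ : Fin (n + 1) => ℝ) j).symm e
    have hesymm : ∀ p : ℝ × (Fin n → ℝ), e.symm p = j.insertNth p.1 p.2 := fun _ => rfl
    have hcube : e.symm ⁻¹' cube (n + 1) = I₀ ×ˢ cube n := by
      ext p
      rw [Set.mem_preimage, hesymm]
      simp only [cube, Set.mem_prod, Set.mem_pi, Set.mem_univ, true_imp_iff]
      rw [Fin.forall_iff_succAbove j]
      simp
    have hint : IntegrableOn (fun p => g' (e.symm p)) (I₀ ×ˢ cube n) := by
      rw [← hcube]
      exact (he.integrableOn_comp_preimage e.symm.measurableEmbedding).2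
        (hg'.integrableOn_compact isCompact_cube)
    rw [← he.setIntegral_preimage_emb e.symm.measurableEmbedding, hcube]
    rw [IntegrableOn, Measure.volume_eq_prod, ← Measure.prod_restrict] at hint
    rw [Measure.volume_eq_prod, ← Measure.prod_restrict, integral_prod_symm _ hint]
    refine (setIntegral_congr_fun measurableSet_cube fun y hy => ?_).trans (integral_zero _ _)
    have hmem : ∀ t ∈ I₀, j.insertNth t y ∈ cube (n + 1) := fun t ht => by
      have : (t, y) ∈ I₀ ×ˢ cube n := ⟨ht, hy⟩
      rwa [← hcube] at this
    have hder' : ∀ t ∈ I₀, HasDerivWithinAt (fun s => g (j.insertNth s y))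
        (g' (j.insertNth t y)) I₀ t := fun t ht => by
      have := hder _ (hmem t ht)
      simpa only [Fin.update_insertNth, Fin.insertNth_apply_same] using this
    have hcont : ContinuousOn (fun t => g' (j.insertNth t y)) I₀ := by
      refine hg'.comp (Continuous.continuousOn ?_) hmem
      exact Continuous.finInsertNth j continuous_id continuous_const
    have hle : (-(1 / 2) : ℝ) ≤ 1 / 2 := by norm_num
    have hftc := intervalIntegral.integral_eq_sub_of_hasDerivAt_of_le hle
      (fun t ht => (hder' t ht).continuousWithinAt)
      (fun t ht => (hder' t (Set.Ioo_subset_Icc_self ht)).hasDerivAt (Icc_mem_nhds ht.1 ht.2))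
      (ContinuousOn.intervalIntegrable_of_Icc hle hcont)
    simp only [hesymm]
    rw [I₀, integral_Icc_eq_integral_Ioc, ← intervalIntegral.integral_of_le hle, hftc,
      hg0 _ (mem_cubeBoundary (i := j) (hmem _ ⟨hle, le_rfl⟩) (Or.inr (by simp))),
      hg0 _ (mem_cubeBoundary (i := j) (hmem _ ⟨le_rfl, hle⟩) (Or.inl (by simp))), sub_zero]

/-- Integration by parts for the Fourier coefficients. -/
theorem cubeCoef_partial {f f' : (Fin d → ℝ) → ℂ} (j : Fin d) (hf : ContinuousOn f (cube d))
    (hf' : ContinuousOn f' (cube d))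
    (hder : ∀ x ∈ cube d, HasDerivWithinAt (fun t => f (Function.update x j t)) (f' x) I₀ (x j))
    (hf0 : ∀ x ∈ cubeBoundary d, f x = 0) (k : Fin d → ℤ) :
    cubeCoef f' k = 2 * Real.pi * Complex.I * k j * cubeCoef f k := by
  have hc := (continuous_character (-k)).continuousOn (s := cube d)
  have h := integral_cube_partial_eq_zero (g := fun x => character (-k) x * f x)
    (g' := fun x => 2 * Real.pi * Complex.I * ((-k) j : ℤ) * character (-k) x * f x +
      character (-k) x * f' x) j (by fun_prop) (fun x hx => by
      have := (hasDerivAt_character_update (-k) x j).hasDerivWithinAt.fun_mul (hder x hx)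
      simpa only [Function.update_eq_self] using this)
    (fun x hx => by simp only [hf0 x hx, mul_zero])
  rw [integral_add] at h
  · simp only [mul_assoc, integral_const_mul] at h
    rw [cubeCoef, cubeCoef, ← sub_eq_zero, ← h]
    simp only [Pi.neg_apply, Int.cast_neg]
    ring
  · exact ContinuousOn.integrableOn_compact isCompact_cube (by fun_prop)
  · exact ContinuousOn.integrableOn_compact isCompact_cube (by fun_prop)

/-! ### Calculus of mixed derivatives -/

/-- All mixed partial derivatives `D^β F` with `β ≤ α`, taken in any order, exist and are
continuous on the closed cube, and vanish on the set `Z`. The recursive form turns the Leibniz rule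
and the chain rule into inductions that need only the first-order rules. -/
inductive HasMixedDerivs (Z : Set (Fin d → ℝ)) : (Fin d → ℕ) → ((Fin d → ℝ) → ℂ) → Prop
  | intro {α : Fin d → ℕ} {F : (Fin d → ℝ) → ℂ} (G : Fin d → (Fin d → ℝ) → ℂ)
      (cont : ContinuousOn F (cube d)) (zero : ∀ x ∈ Z, F x = 0)
      (deriv : ∀ j, 0 < α j → ∀ x ∈ cube d,
        HasDerivWithinAt (fun t => F (Function.update x j t)) (G j x) I₀ (x j))
      (next : ∀ j, 0 < α j → HasMixedDerivs Z (α - Pi.single j 1) (G j)) :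
      HasMixedDerivs Z α F

namespace HasMixedDerivs

variable {Z : Set (Fin d → ℝ)} {α β : Fin d → ℕ} {F G : (Fin d → ℝ) → ℂ}

theorem continuousOn (h : HasMixedDerivs Z α F) : ContinuousOn F (cube d) := by
  obtain ⟨_, cont, -⟩ := h
  exact cont

theorem eq_zero (h : HasMixedDerivs Z α F) : ∀ x ∈ Z, F x = 0 := by
  obtain ⟨_, -, zero, -⟩ := h
  exact zero

theorem exists_partial (h : HasMixedDerivs Z α F) :
    ∃ G : Fin d → (Fin d → ℝ) → ℂ,
      (∀ j, 0 < α j → ∀ x ∈ cube d,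
        HasDerivWithinAt (fun t => F (Function.update x j t)) (G j x) I₀ (x j)) ∧
      ∀ j, 0 < α j → HasMixedDerivs Z (α - Pi.single j 1) (G j) := by
  obtain ⟨G, -, -, deriv, next⟩ := h
  exact ⟨G, deriv, next⟩

theorem mono (h : HasMixedDerivs Z α F) (hβ : β ≤ α) : HasMixedDerivs Z β F := by
  induction h generalizing β with
  | intro G cont zero deriv _ ih =>
    exact intro G cont zero (fun j hj => deriv j (hj.trans_le (hβ j)))
      fun j hj => ih j (hj.trans_le (hβ j)) (tsub_le_tsub_right hβ _)

theorem congr (h : HasMixedDerivs Z α F) (hZ : Z ⊆ cube d) (hG : Set.EqOn G F (cube d)) :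
    HasMixedDerivs Z α G := by
  obtain ⟨G', cont, zero, deriv, next⟩ := h
  refine intro G' (cont.congr hG) (fun x hx => (hG (hZ hx)).trans (zero x hx))
    (fun j hj x hx => (deriv j hj x hx).congr (fun t ht => hG (update_mem_cube hx j ht)) ?_) next
  rw [Function.update_eq_self]
  exact hG hx

theorem add (hF : HasMixedDerivs Z α F) (hG : HasMixedDerivs Z α G) :
    HasMixedDerivs Z α (fun x => F x + G x) := by
  induction hF generalizing G with
  | intro F' cont zero deriv _ ih =>
    obtain ⟨G', cont', zero', deriv', next'⟩ := hG
    exact intro (fun j x => F' j x + G' j x) (cont.add cont')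
      (fun x hx => by rw [zero x hx, zero' x hx, add_zero])
      (fun j hj x hx => (deriv j hj x hx).fun_add (deriv' j hj x hx))
      fun j hj => ih j hj (next' j hj)

theorem sub_single_lt {j : Fin d} (hj : 0 < α j) : α - Pi.single j 1 < α := by
  refine Pi.lt_def.2 ⟨tsub_le_self, j, ?_⟩
  rw [Pi.sub_apply, Pi.single_eq_same]
  omega

/-- Leibniz rule; zeros of one factor are zeros of the product. -/
theorem mul {Y : Set (Fin d → ℝ)} (hF : HasMixedDerivs Y α F) (hG : HasMixedDerivs Z α G) :
    HasMixedDerivs Z α (fun x => F x * G x) := by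
  induction α using WellFoundedLT.induction generalizing F G with
  | ind α ih =>
    obtain ⟨F', derivF, nextF⟩ := hF.exists_partial
    obtain ⟨G', derivG, nextG⟩ := hG.exists_partial
    refine intro (fun j x => F' j x * G x + F x * G' j x) (hF.continuousOn.mul hG.continuousOn)
      (fun x hx => by rw [hG.eq_zero x hx, mul_zero]) (fun j hj x hx => ?_) fun j hj => ?_
    · have := (derivF j hj x hx).fun_mul (derivG j hj x hx)
      simpa only [Function.update_eq_self] using this
    · have hlt := sub_single_lt hj
      exact (ih _ hlt (nextF j hj) (hG.mono hlt.le)).add (ih _ hlt (hF.mono hlt.le) (nextG j hj))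

theorem mapCube_update (ψ : Fin d → ℝ → ℝ) (x : Fin d → ℝ) (j : Fin d) (t : ℝ) :
    mapCube ψ (Function.update x j t) = Function.update (mapCube ψ x) j (ψ j t) := by
  funext i
  rcases eq_or_ne i j with rfl | hij
  · simp [mapCube]
  · simp [mapCube, Function.update_of_ne hij]

/-- Chain rule for a coordinatewise substitution, with `P j` the derivative of `ψ j`. -/
theorem comp_mapCube {ψ : Fin d → ℝ → ℝ} {P : Fin d → (Fin d → ℝ) → ℝ}
    (hmaps : ∀ j, Set.MapsTo (ψ j) I₀ I₀) (hcont : ContinuousOn (mapCube ψ) (cube d))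
    (hP : ∀ j, 0 < α j → ∀ x ∈ cube d, HasDerivWithinAt (ψ j) (P j x) I₀ (x j))
    (hP' : ∀ j, 0 < α j → HasMixedDerivs ∅ (α - Pi.single j 1) fun x => (P j x : ℂ))
    (hF : HasMixedDerivs ∅ α F) : HasMixedDerivs ∅ α fun x => F (mapCube ψ x) := by
  have hmapsTo : Set.MapsTo (mapCube ψ) (cube d) (cube d) := fun x hx i _ =>
    hmaps i (hx i trivial)
  induction hF with
  | @intro α F F' cont _ deriv _ ih =>
    refine intro (fun j x => F' j (mapCube ψ x) * P j x) (cont.comp hcont hmapsTo)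
      (fun x hx => hx.elim) (fun j hj x hx => ?_) fun j hj => ?_
    · simp_rw [mapCube_update]
      have := HasDerivWithinAt.scomp (x j) (deriv j hj (mapCube ψ x) (hmapsTo hx)) (hP j hj x hx)
        (hmaps j)
      rw [mul_comm]
      exact this
    · have hle : ∀ i, (α - Pi.single j 1 : Fin d → ℕ) i ≤ α i := fun i => (sub_single_lt hj).le i
      exact (ih j hj (fun i hi => hP i (hi.trans_le (hle i))) fun i hi =>
        (hP' i (hi.trans_le (hle i))).mono (tsub_le_tsub_right hle _)).mul (hP' j hj)

end HasMixedDerivs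

variable {E : Type*} [NormedAddCommGroup E] [NormedSpace ℝ E]

/-- A family of mixed derivatives satisfies the recursive description, also for vector-valued
functions after composition with a continuous linear functional `L`. -/
theorem IsMixedDeriv.hasMixedDerivs {Z : Set (Fin d → ℝ)} {m : ℕ} {F : (Fin d → ℝ) → E}
    {D : (Fin d → ℕ) → (Fin d → ℝ) → E} (hD : IsMixedDeriv m F D)
    (hcont : ∀ α : Fin d → ℕ, (∀ i, α i ≤ m) → ContinuousOn (D α) (cube d))
    (hzero : ∀ α : Fin d → ℕ, (∀ i, α i ≤ m) → ∀ x ∈ Z, D α x = 0)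
    (L : E →L[ℝ] ℂ) (α : Fin d → ℕ) (β : Fin d → ℕ) (h : ∀ i, β i + α i ≤ m) :
    HasMixedDerivs Z α fun x => L (D β x) := by
  induction α using WellFoundedLT.induction generalizing β with
  | ind α ih =>
    have hβ : ∀ i, β i ≤ m := fun i => (Nat.le_add_right _ _).trans (h i)
    refine .intro (fun j x => L (D (β + Pi.single j 1) x)) (L.continuous.comp_continuousOn
      (hcont β hβ)) (fun x hx => by rw [hzero β hβ x hx, map_zero]) (fun j hj x hx => ?_)
      fun j hj => ?_
    · have := h j
      exact L.hasFDerivAt.comp_hasDerivWithinAt (x j) (hD.succ β hβ j (by omega) x hx)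
    · refine ih _ (HasMixedDerivs.sub_single_lt hj) _ fun i => ?_
      have := h i
      rcases eq_or_ne i j with rfl | hij
      · simp only [Pi.add_apply, Pi.sub_apply, Pi.single_eq_same]
        omega
      · simpa [Pi.single_eq_of_ne hij] using this

theorem CMix.hasMixedDerivs {m : ℕ} {F : (Fin d → ℝ) → ℂ} (hF : CMix m F) {α : Fin d → ℕ}
    (hα : ∀ i, α i ≤ m) : HasMixedDerivs ∅ α F := by
  obtain ⟨D, hD, hcont⟩ := hF
  refine (hD.hasMixedDerivs (Z := ∅) hcont (fun _ _ x hx => hx.elim)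
    (ContinuousLinearMap.id ℝ ℂ) α 0 (by simpa using hα)).congr (Set.empty_subset _) fun x hx => ?_
  simp [hD.zero x hx]

theorem CMixZero.hasMixedDerivs {m : ℕ} {F : (Fin d → ℝ) → ℝ} (hF : CMixZero m F) {α : Fin d → ℕ}
    (hα : ∀ i, α i ≤ m) : HasMixedDerivs (cubeBoundary d) α fun x => (F x : ℂ) := by
  obtain ⟨D, hD, hD'⟩ := hF
  refine (hD.hasMixedDerivs (Z := cubeBoundary d) (fun α hα => (hD' α hα).1)
    (fun α hα => (hD' α hα).2) Complex.ofRealCLM α 0 (by simpa using hα)).congr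
    Set.sdiff_subset fun x hx => ?_
  simp [hD.zero x hx]

/-- The derivative of `ψ j` is read off from the `j`-th component of the partial derivative of
`mapCube ψ` in direction `j`. -/
theorem CMix.comp_mapCube {m : ℕ} (hm : 1 ≤ m) {ψ : Fin d → ℝ → ℝ} (hψ : CMix m (mapCube ψ))
    (hmaps : ∀ j, Set.MapsTo (ψ j) I₀ I₀)
    {h : (Fin d → ℝ) → ℂ} (hh : CMix m h) {α : Fin d → ℕ} (hα : ∀ i, α i ≤ m) :
    HasMixedDerivs ∅ α fun x => h (mapCube ψ x) := by
  obtain ⟨D, hD, hcont⟩ := hψ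
  refine HasMixedDerivs.comp_mapCube (P := fun j x => D (Pi.single j 1) x j) hmaps
    ((hcont 0 fun _ => Nat.zero_le _).congr fun x hx => (hD.zero x hx).symm)
    (fun j hj x hx => ?_) (fun j hj => ?_) (hh.hasMixedDerivs hα)
  · have h1 := hD.succ 0 (fun _ => Nat.zero_le _) j hm x hx
    rw [zero_add] at h1
    refine ((hasDerivWithinAt_pi.1 h1) j).congr_of_mem (fun t ht => ?_) (hx j trivial)
    rw [hD.zero _ (update_mem_cube hx j ht), mapCube, Function.update_self]
  · refine hD.hasMixedDerivs (Z := ∅) hcont (fun _ _ x hx => hx.elim)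
      (Complex.ofRealCLM.comp (ContinuousLinearMap.proj j)) _ _ fun i => ?_
    have := hα i
    rcases eq_or_ne i j with rfl | hij
    · simp only [Pi.sub_apply, Pi.single_eq_same]
      omega
    · simpa [Pi.single_eq_of_ne hij] using this

/-! ### Decay of Fourier coefficients -/

theorem HasMixedDerivs.summable_cubeCoef {α : Fin d → ℕ} {F : (Fin d → ℝ) → ℂ}
    (hF : HasMixedDerivs (cubeBoundary d) α F) :
    Summable fun k : Fin d → ℤ => (∏ j, |(k j : ℝ)| ^ α j) ^ 2 * ‖cubeCoef F k‖ ^ 2 := by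
  induction hF with
  | @intro α F G cont zero deriv next ih =>
    by_cases hα : α = 0
    · subst hα
      simpa using summable_norm_cubeCoef_sq cont zero
    · obtain ⟨j, hj⟩ := Function.ne_iff.1 hα
      have hj : 0 < α j := Nat.pos_of_ne_zero hj
      refine (ih j hj).of_nonneg_of_le (fun k => by positivity) fun k => ?_
      rw [cubeCoef_partial j cont (next j hj).continuousOn (deriv j hj) zero k]
      have hprod : ∏ i, |(k i : ℝ)| ^ α i =
          (∏ i, |(k i : ℝ)| ^ (α - Pi.single j 1 : Fin d → ℕ) i) * |(k j : ℝ)| := by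
        have h1 : α = (α - Pi.single j 1) + Pi.single j 1 := by
          rw [tsub_add_cancel_of_le]
          intro i
          rcases eq_or_ne i j with rfl | hij
          · rw [Pi.single_eq_same]
            exact hj
          · rw [Pi.single_eq_of_ne hij]
            exact Nat.zero_le _
        have h2 : ∏ i, |(k i : ℝ)| ^ (Pi.single j 1 : Fin d → ℕ) i = |(k j : ℝ)| := by
          rw [Finset.prod_eq_single j (fun i _ hij => by rw [Pi.single_eq_of_ne hij, pow_zero])
            (by simp), Pi.single_eq_same, pow_one]
        rw [← h2, ← Finset.prod_mul_distrib]
        refine Finset.prod_congr rfl fun i _ => ?_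
        rw [← pow_add, ← Pi.add_apply, ← h1]
      have hnorm : ‖(2 * Real.pi * Complex.I * k j : ℂ)‖ = 2 * Real.pi * |(k j : ℝ)| := by
        simp [abs_of_pos Real.pi_pos]
      rw [hprod, norm_mul, hnorm, ← mul_pow, ← mul_pow]
      refine pow_le_pow_left₀ (by positivity) ?_ 2
      rw [mul_assoc]
      refine mul_le_mul_of_nonneg_left (mul_le_mul_of_nonneg_right ?_ (norm_nonneg _))
        (by positivity)
      have : 1 ≤ 2 * Real.pi := by linarith [Real.pi_gt_three]
      exact le_mul_of_one_le_left (abs_nonneg _) this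

/-- Mixed derivatives that vanish on the boundary give square-summability with the weight
`ω_hc(k)^{2m} = ∏_{k_j ≠ 0} |k_j|^{2m}`: for each `k` the derivative of order `m` in the coordinates
with `k_j ≠ 0` is used. -/
theorem summable_hcWeight_mul_cubeCoef {m : ℕ} {F : (Fin d → ℝ) → ℂ}
    (hF : ∀ α : Fin d → ℕ, (∀ i, α i ≤ m) → HasMixedDerivs (cubeBoundary d) α F) :
    Summable fun k : Fin d → ℤ => (hcWeight k : ℝ) ^ (2 * m) * ‖cubeCoef F k‖ ^ 2 := by
  classical
  have hs : Summable fun k : Fin d → ℤ => ∑ S : Finset (Fin d),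
      (∏ j, |(k j : ℝ)| ^ (if j ∈ S then m else 0)) ^ 2 * ‖cubeCoef F k‖ ^ 2 :=
    summable_sum fun S _ => (hF (fun j => if j ∈ S then m else 0)
      fun j => by split_ifs <;> simp).summable_cubeCoef
  have hnn : ∀ k : Fin d → ℤ, 0 ≤ (hcWeight k : ℝ) := fun k => by
    exact_mod_cast zero_le_one.trans (one_le_hcWeight k)
  refine hs.of_nonneg_of_le (fun k => by have := hnn k; positivity) fun k => ?_
  refine le_trans (le_of_eq ?_) (Finset.single_le_sum
    (f := fun S : Finset (Fin d) =>
      (∏ j, |(k j : ℝ)| ^ (if j ∈ S then m else 0)) ^ 2 * ‖cubeCoef F k‖ ^ 2)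
    (fun S _ => by positivity) (Finset.mem_univ (Finset.univ.filter fun j => k j ≠ 0)))
  congr 1
  rw [mul_comm 2 m, pow_mul, hcWeight, Int.cast_prod, ← Finset.prod_pow]
  congr 1
  refine Finset.prod_congr rfl fun j _ => ?_
  by_cases hk : k j = 0
  · simp [hk]
  · have : (1 : ℤ) ≤ |k j| := Int.one_le_abs hk
    simp [hk, max_eq_right this]

/-! ### The change of variables -/

namespace IsTorusToCube

variable {ψ : ℝ → ℝ}

theorem mapsTo (hψ : IsTorusToCube ψ) : Set.MapsTo ψ I₀ I₀ := by
  intro x hx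
  have hle : (-(1 / 2) : ℝ) ≤ 1 / 2 := by norm_num
  have h1 := hψ.strictMonoOn.monotoneOn (Set.left_mem_Icc.2 hle) hx hx.1
  have h2 := hψ.strictMonoOn.monotoneOn hx (Set.right_mem_Icc.2 hle) hx.2
  rw [hψ.left] at h1
  rw [hψ.right] at h2
  exact ⟨h1, h2⟩

theorem inv_apply (hψ : IsTorusToCube ψ) {x : ℝ} (hx : x ∈ I₀) : inv ψ (ψ x) = x :=
  hψ.strictMonoOn.injOn.leftInvOn_invFunOn hx

theorem hasDerivWithinAt (hψ : IsTorusToCube ψ) {x : ℝ} (hx : x ∈ I₀) :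
    HasDerivWithinAt ψ (der ψ x) I₀ x :=
  (hψ.contDiffOn.differentiableOn one_ne_zero x hx).hasDerivWithinAt

theorem der_nonneg (hψ : IsTorusToCube ψ) (x : ℝ) : 0 ≤ der ψ x :=
  hψ.strictMonoOn.monotoneOn.derivWithin_nonneg

theorem image_Ioo (hψ : IsTorusToCube ψ) :
    ψ '' Set.Ioo (-(1 / 2)) (1 / 2) = Set.Ioo (-(1 / 2)) (1 / 2) := by
  have hle : (-(1 / 2) : ℝ) ≤ 1 / 2 := by norm_num
  apply Set.Subset.antisymm
  · rintro _ ⟨x, hx, rfl⟩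
    have h1 := hψ.strictMonoOn (Set.left_mem_Icc.2 hle) (Set.Ioo_subset_Icc_self hx) hx.1
    have h2 := hψ.strictMonoOn (Set.Ioo_subset_Icc_self hx) (Set.right_mem_Icc.2 hle) hx.2
    rw [hψ.left] at h1
    rw [hψ.right] at h2
    exact ⟨h1, h2⟩
  · have := intermediate_value_Ioo hle hψ.contDiffOn.continuousOn
    rwa [hψ.left, hψ.right] at this

end IsTorusToCube

variable {ω ψ : Fin d → ℝ → ℝ}

theorem image_mapCube_openCube (hψ : ∀ j, IsTorusToCube (ψ j)) :
    mapCube ψ '' openCube d = openCube d := by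
  apply Set.Subset.antisymm
  · rintro _ ⟨x, hx, rfl⟩ j _
    rw [← (hψ j).image_Ioo]
    exact Set.mem_image_of_mem _ (hx j trivial)
  · intro y hy
    have : ∀ j, ∃ t ∈ Set.Ioo (-(1 / 2) : ℝ) (1 / 2), ψ j t = y j := fun j => by
      have := hy j trivial
      rwa [← (hψ j).image_Ioo] at this
    choose x hx hxy using this
    exact ⟨x, fun j _ => hx j, funext hxy⟩

theorem injOn_mapCube (hψ : ∀ j, IsTorusToCube (ψ j)) : Set.InjOn (mapCube ψ) (cube d) :=
  fun _ hx _ hy h => funext fun j =>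
    (hψ j).strictMonoOn.injOn (hx j trivial) (hy j trivial) (congrFun h j)

/-- The Jacobian determinant of `mapCube ψ`. -/
noncomputable def jacobian (ψ : Fin d → ℝ → ℝ) (x : Fin d → ℝ) : ℝ := ∏ j, der (ψ j) (x j)

theorem jacobian_nonneg (hψ : ∀ j, IsTorusToCube (ψ j)) (x : Fin d → ℝ) : 0 ≤ jacobian ψ x :=
  Finset.prod_nonneg fun j _ => (hψ j).der_nonneg _

/-- The total derivative of `mapCube ψ`. -/
noncomputable def mapCubeDeriv (ψ : Fin d → ℝ → ℝ) (x : Fin d → ℝ) :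
    (Fin d → ℝ) →L[ℝ] (Fin d → ℝ) :=
  ContinuousLinearMap.pi fun j =>
    (ContinuousLinearMap.toSpanSingleton ℝ (der (ψ j) (x j))).comp (ContinuousLinearMap.proj j)

theorem det_mapCubeDeriv (x : Fin d → ℝ) : (mapCubeDeriv ψ x).det = jacobian ψ x := by
  rw [mapCubeDeriv, ContinuousLinearMap.det_pi, jacobian]
  refine Finset.prod_congr rfl fun j _ => ?_
  simp [ContinuousLinearMap.det]

theorem hasFDerivWithinAt_mapCube (hψ : ∀ j, IsTorusToCube (ψ j)) {x : Fin d → ℝ}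
    (hx : x ∈ openCube d) : HasFDerivWithinAt (mapCube ψ) (mapCubeDeriv ψ x) (openCube d) x := by
  refine hasFDerivWithinAt_pi.2 fun j => HasFDerivAt.hasFDerivWithinAt ?_
  have h1 : HasDerivAt (ψ j) (der (ψ j) (x j)) (x j) :=
    ((hψ j).hasDerivWithinAt (openCube_subset_cube hx j trivial)).hasDerivAt
      (Icc_mem_nhds (hx j trivial).1 (hx j trivial).2)
  exact h1.hasFDerivAt.comp x (hasFDerivAt_apply j x)

theorem measurableSet_openCube : MeasurableSet (openCube d) :=
  MeasurableSet.univ_pi fun _ => measurableSet_Ioo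

theorem integral_cube_eq_integral_jacobian_smul {E : Type*} [NormedAddCommGroup E]
    [NormedSpace ℝ E] (hψ : ∀ j, IsTorusToCube (ψ j)) (g : (Fin d → ℝ) → E) :
    ∫ y in cube d, g y = ∫ x in openCube d, jacobian ψ x • g (mapCube ψ x) := by
  have h := integral_image_eq_integral_abs_det_fderiv_smul volume measurableSet_openCube
    (fun x hx => hasFDerivWithinAt_mapCube hψ hx)
    ((injOn_mapCube hψ).mono openCube_subset_cube) g
  rw [image_mapCube_openCube hψ] at h
  rw [← setIntegral_congr_set openCube_ae_eq_cube, h]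
  simp_rw [det_mapCubeDeriv, abs_of_nonneg (jacobian_nonneg hψ _)]

theorem integrableOn_cube_iff_jacobian_smul {E : Type*} [NormedAddCommGroup E]
    [NormedSpace ℝ E] (hψ : ∀ j, IsTorusToCube (ψ j)) (g : (Fin d → ℝ) → E) :
    IntegrableOn g (cube d) ↔
      IntegrableOn (fun x => jacobian ψ x • g (mapCube ψ x)) (openCube d) := by
  have h := integrableOn_image_iff_integrableOn_abs_det_fderiv_smul volume measurableSet_openCube
    (fun x hx => hasFDerivWithinAt_mapCube hψ hx)
    ((injOn_mapCube hψ).mono openCube_subset_cube) g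
  rw [image_mapCube_openCube hψ] at h
  rw [← integrableOn_congr_set_ae openCube_ae_eq_cube, h]
  simp_rw [det_mapCubeDeriv, abs_of_nonneg (jacobian_nonneg hψ _)]

/-- The function `x ↦ ∏_j √(ϱ_j(ψ_j(x_j)) / ω_j(ψ_j(x_j)))`, the modulus of `φ_k` after the
substitution. -/
noncomputable def sqrtRatio (ω ψ : Fin d → ℝ → ℝ) (x : Fin d → ℝ) : ℝ :=
  ∏ j, Real.sqrt (density (ψ j) (ψ j (x j)) / ω j (ψ j (x j)))

theorem density_apply {ψ : ℝ → ℝ} (hψ : IsTorusToCube ψ) {x : ℝ} (hx : x ∈ I₀) :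
    density ψ (ψ x) = (der ψ x)⁻¹ := by
  rw [density, hψ.inv_apply hx, one_div]

theorem weight_nonneg (hω : IsWeight ω) (hψ : ∀ j, IsTorusToCube (ψ j)) {x : Fin d → ℝ}
    (hx : x ∈ cube d) (j : Fin d) : 0 ≤ ω j (ψ j (x j)) :=
  (hω j).1 _ ((hψ j).mapsTo (hx j trivial))

theorem sqrtWeight_sq (hω : IsWeight ω) (hψ : ∀ j, IsTorusToCube (ψ j)) {x : Fin d → ℝ}
    (hx : x ∈ cube d) :
    sqrtWeight ω ψ x ^ 2 = jacobian ψ x * prodFun ω (mapCube ψ x) := by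
  rw [sqrtWeight, jacobian, prodFun, ← Finset.prod_pow, ← Finset.prod_mul_distrib]
  refine Finset.prod_congr rfl fun j _ => ?_
  rw [Real.sq_sqrt (mul_nonneg (weight_nonneg hω hψ hx j) ((hψ j).der_nonneg _)), mapCube, mul_comm]

/-- At zeros of `ω_j ∘ ψ_j` or of `ψ_j'` both sides vanish. -/
theorem sqrtRatio_mul_sqrtWeight_sq (hψ : ∀ j, IsTorusToCube (ψ j)) {x : Fin d → ℝ}
    (hx : x ∈ cube d) : sqrtRatio ω ψ x * sqrtWeight ω ψ x ^ 2 = sqrtWeight ω ψ x := by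
  rw [sqrtRatio, sqrtWeight, ← Finset.prod_pow, ← Finset.prod_mul_distrib]
  refine Finset.prod_congr rfl fun j _ => ?_
  rw [density_apply (hψ j) (hx j trivial), div_eq_mul_inv, ← mul_inv, mul_comm (der _ _),
    Real.sqrt_inv]
  set t := √(ω j (ψ j (x j)) * der (ψ j) (x j))
  by_cases ht : t = 0
  · simp [ht]
  · field_simp

theorem phi_mapCube (hψ : ∀ j, IsTorusToCube (ψ j)) {x : Fin d → ℝ} (hx : x ∈ cube d)
    (k : Fin d → ℤ) : phi ω ψ k (mapCube ψ x) = sqrtRatio ω ψ x * character k x := by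
  rw [character_eq_exp, Finset.mul_sum, Complex.exp_sum, sqrtRatio, Complex.ofReal_prod,
    ← Finset.prod_mul_distrib, phi]
  refine Finset.prod_congr rfl fun j _ => ?_
  rw [phi₁, mapCube, (hψ j).inv_apply (hx j trivial)]
  congr 2
  ring

/-- The function `(h ∘ ψ) ∏_j √((ω_j ∘ ψ_j) ψ_j')` on the cube to which `h` is transformed. -/
noncomputable def transformed (ω ψ : Fin d → ℝ → ℝ) (h : (Fin d → ℝ) → ℂ) (x : Fin d → ℝ) : ℂ :=
  h (mapCube ψ x) * sqrtWeight ω ψ x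

theorem fourierCoef_eq_cubeCoef (hω : IsWeight ω) (hψ : ∀ j, IsTorusToCube (ψ j))
    (h : (Fin d → ℝ) → ℂ) (k : Fin d → ℤ) :
    fourierCoef ω ψ h k = cubeCoef (transformed ω ψ h) k := by
  rw [fourierCoef, weightedInner, integral_cube_eq_integral_jacobian_smul hψ, cubeCoef,
    ← setIntegral_congr_set openCube_ae_eq_cube]
  refine setIntegral_congr_fun measurableSet_openCube fun x hx => ?_
  have hx' := openCube_subset_cube hx
  have hconj : (starRingEnd ℂ) (character k x) = character (-k) x := mFourier_neg.symm
  have hs : ((sqrtRatio ω ψ x : ℝ) : ℂ) * (jacobian ψ x * prodFun ω (mapCube ψ x)) =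
      sqrtWeight ω ψ x := by
    rw [← Complex.ofReal_mul, ← sqrtWeight_sq hω hψ hx', ← Complex.ofReal_mul,
      sqrtRatio_mul_sqrtWeight_sq hψ hx']
  simp only [phi_mapCube hψ hx', map_mul, Complex.conj_ofReal, hconj, Complex.real_smul,
    transformed, ← hs]
  ring

/-- Where `sqrtWeight` vanishes, the left-hand side does, but the trigonometric polynomial need not:
the functions `φ_k` are orthonormal only where the weight is positive. -/
theorem jacobian_mul_norm_sub_sum_phi_sq (hω : IsWeight ω) (hψ : ∀ j, IsTorusToCube (ψ j))
    (h : (Fin d → ℝ) → ℂ) (I : Finset (Fin d → ℤ)) (c : (Fin d → ℤ) → ℂ) {x : Fin d → ℝ}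
    (hx : x ∈ cube d) :
    jacobian ψ x * (‖h (mapCube ψ x) - ∑ k ∈ I, c k * phi ω ψ k (mapCube ψ x)‖ ^ 2 *
        prodFun ω (mapCube ψ x)) =
      if sqrtWeight ω ψ x = 0 then 0 else
        ‖transformed ω ψ h x - ∑ k ∈ I, c k * character k x‖ ^ 2 := by
  rw [mul_left_comm, ← sqrtWeight_sq hω hψ hx]
  split_ifs with hs
  · simp [hs]
  have hR : sqrtRatio ω ψ x * sqrtWeight ω ψ x = 1 := by
    have := sqrtRatio_mul_sqrtWeight_sq (ω := ω) hψ hx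
    rw [pow_two, ← mul_assoc] at this
    exact mul_right_cancel₀ hs (this.trans (one_mul _).symm)
  have hR' : (sqrtRatio ω ψ x : ℂ) * sqrtWeight ω ψ x = 1 := by exact_mod_cast hR
  have heq : transformed ω ψ h x - ∑ k ∈ I, c k * character k x =
      (h (mapCube ψ x) - ∑ k ∈ I, c k * phi ω ψ k (mapCube ψ x)) * sqrtWeight ω ψ x := by
    rw [sub_mul, Finset.sum_mul, transformed]
    congr 1
    refine Finset.sum_congr rfl fun k _ => ?_
    rw [phi_mapCube hψ hx]
    linear_combination (-(c k * character k x)) * hR'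
  rw [heq, norm_mul, mul_pow, Complex.norm_real, Real.norm_eq_abs, sq_abs]

/-- The weighted `L_2` error on the cube is at most the unweighted one after the substitution. -/
theorem weighted_error_le (hω : IsWeight ω) (hψ : ∀ j, IsTorusToCube (ψ j))
    {h : (Fin d → ℝ) → ℂ} (hs : ContinuousOn (sqrtWeight ω ψ) (cube d))
    (hf : ContinuousOn (transformed ω ψ h) (cube d))
    (I : Finset (Fin d → ℤ)) (c : (Fin d → ℤ) → ℂ) :
    FiniteWeightedNorm ω (fun y => h y - ∑ k ∈ I, c k * phi ω ψ k y) ∧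
      ∫ y in cube d, ‖h y - ∑ k ∈ I, c k * phi ω ψ k y‖ ^ 2 * prodFun ω y ≤
        ∫ x in cube d, ‖transformed ω ψ h x - ∑ k ∈ I, c k * character k x‖ ^ 2 := by
  set T := openCube d ∩ sqrtWeight ω ψ ⁻¹' {0}ᶜ with hT
  have hTm : MeasurableSet T :=
    ((hs.mono openCube_subset_cube).isOpen_inter_preimage
      (isOpen_set_pi Set.finite_univ fun _ _ => isOpen_Ioo) isOpen_compl_singleton).measurableSet
  have hcongr : Set.EqOn (fun x => jacobian ψ x •
      (‖h (mapCube ψ x) - ∑ k ∈ I, c k * phi ω ψ k (mapCube ψ x)‖ ^ 2 * prodFun ω (mapCube ψ x)))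
      (T.indicator fun x => ‖transformed ω ψ h x - ∑ k ∈ I, c k * character k x‖ ^ 2)
      (openCube d) := by
    intro x hx
    simp only [smul_eq_mul]
    rw [jacobian_mul_norm_sub_sum_phi_sq hω hψ h I c (openCube_subset_cube hx)]
    by_cases h0 : sqrtWeight ω ψ x = 0
    · rw [if_pos h0, Set.indicator_of_notMem fun hxT => hxT.2 h0]
    · rw [if_neg h0, Set.indicator_of_mem (show x ∈ T from ⟨hx, h0⟩)]
  have hcont : ContinuousOn (fun x => ‖transformed ω ψ h x - ∑ k ∈ I, c k * character k x‖ ^ 2)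
      (cube d) := by
    have := fun k => (continuous_character k).continuousOn (s := cube d)
    fun_prop
  have hint : IntegrableOn (fun x => ‖transformed ω ψ h x - ∑ k ∈ I, c k * character k x‖ ^ 2)
      (openCube d) :=
    (hcont.integrableOn_compact isCompact_cube).mono_set openCube_subset_cube
  constructor
  · rw [FiniteWeightedNorm, integrableOn_cube_iff_jacobian_smul hψ,
      integrableOn_congr_fun hcongr measurableSet_openCube]
    exact Integrable.indicator hint hTm
  · rw [integral_cube_eq_integral_jacobian_smul hψ, setIntegral_congr_fun measurableSet_openCube
      hcongr, ← setIntegral_congr_set openCube_ae_eq_cube]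
    refine setIntegral_mono (Integrable.indicator hint hTm) hint fun x => ?_
    exact Set.indicator_le_self' (fun _ _ => by positivity) x

/-! ### The lattice rule on the cube and on the torus -/

theorem node_mem_cube (z : Fin d → ℤ) (M j : ℕ) : node z M j ∈ cube d := by
  intro i _
  rw [node, I₀, Set.mem_Icc]
  have h1 := Int.fract_nonneg ((j : ℝ) / M * z i + 1 / 2)
  have h2 := Int.fract_lt_one ((j : ℝ) / M * z i + 1 / 2)
  constructor <;> linarith

theorem torusPoint_node (z : Fin d → ℤ) (M j : ℕ) :
    torusPoint (node z M j) = torusNode z M j := by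
  funext i
  rw [torusPoint, torusNode, ← sub_eq_zero, ← AddCircle.coe_sub, AddCircle.coe_eq_zero_iff]
  refine ⟨-⌊(j : ℝ) / M * z i + 1 / 2⌋, ?_⟩
  rw [node, Int.fract, zsmul_eq_mul]
  push_cast
  ring

theorem latticeCoef_eq_torusLatticeCoef (hψ : ∀ j, IsTorusToCube (ψ j))
    (hω : IsWeight ω) (z : Fin d → ℤ) (M : ℕ) {h : (Fin d → ℝ) → ℂ}
    {F : C(UnitAddTorus (Fin d), ℂ)} (hF : ∀ x ∈ cube d, F (torusPoint x) = transformed ω ψ h x)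
    (k : Fin d → ℤ) : latticeCoef ω ψ z M h k = torusLatticeCoef z M F k := by
  rw [latticeCoef, torusLatticeCoef]
  congr 1
  refine Finset.sum_congr rfl fun j _ => ?_
  have hx := node_mem_cube z M j
  rw [← torusPoint_node]
  set x := node z M j
  have hsqrt : √(prodFun ω (mapCube ψ x) / prodFun (fun i => density (ψ i)) (mapCube ψ x)) =
      sqrtWeight ω ψ x := by
    rw [prodFun, prodFun, ← Finset.prod_div_distrib, sqrtWeight, Real.sqrt_prod]
    · refine Finset.prod_congr rfl fun i _ => ?_
      rw [mapCube, density_apply (hψ i) (hx i trivial), div_inv_eq_mul]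
    · intro i _
      rw [mapCube, density_apply (hψ i) (hx i trivial), div_inv_eq_mul]
      exact mul_nonneg (weight_nonneg hω hψ hx i) ((hψ i).der_nonneg _)
  have hchar : mFourier (-k) (torusPoint x) =
      Complex.exp (-(2 * Real.pi * Complex.I * ∑ i, (k i : ℂ) * inv (ψ i) (mapCube ψ x i))) := by
    rw [← character, character_eq_exp, ← mul_neg, ← Finset.sum_neg_distrib]
    congr 2
    refine Finset.sum_congr rfl fun i _ => ?_
    rw [mapCube, (hψ i).inv_apply (hx i trivial)]
    push_cast [Pi.neg_apply]
    ring
  simp only [hsqrt, hF x hx, hchar, transformed]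

end CubeApprox

theorem mainTheorem3 (d m : ℕ) (hd : 1 ≤ d) (hm : 1 ≤ m) :
    ∃ C : ℝ, 0 < C ∧
      ∀ (N : ℕ), 2 ^ (d + 1) ≤ N →
      ∀ (z : Fin d → ℤ) (M : ℕ), 0 < M → IsReconstructing z M (hyperbolicCross d N) →
      ∀ (ω : Fin d → ℝ → ℝ), IsWeight ω →
      ∀ (ψ : Fin d → ℝ → ℝ), (∀ j, IsTorusToCube (ψ j)) →
      CMix m (mapCube ψ) → CMixZero m (sqrtWeight ω ψ) →
      ∀ (h : (Fin d → ℝ) → ℂ), MemWeightedL2 ω h → CMix m h →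
        MemH m ω ψ h ∧
        FiniteWeightedNorm ω (fun y => h y - latticeSum ω ψ z M (hyperbolicCross d N) h y) ∧
        weightedNorm ω (fun y => h y - latticeSum ω ψ z M (hyperbolicCross d N) h y) ≤
          C * (N : ℝ) ^ (-(m : ℤ)) * Real.log N ^ (((d : ℝ) - 1) / 2) * normH m ω ψ h := by
  obtain ⟨d, rfl⟩ := Nat.exists_eq_add_of_le' hd
  set K : ℝ := 2 * 4 ^ (d + 1) * (5 * Real.exp 1 * 5 ^ d) + 1 with hK
  have hK0 : 0 < K := by positivity
  refine ⟨√K, Real.sqrt_pos.2 hK0, ?_⟩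
  intro N hN z M hM hrec ω hω ψ hψ hψm hsm h hh hhm
  have hN4 : 4 ≤ N := by
    have : 2 ^ 2 ≤ 2 ^ (d + 1 + 1) := Nat.pow_le_pow_right (by norm_num) (by omega)
    omega
  have hN0 : 0 < N := by omega
  have hN0' : (0 : ℝ) < N := by exact_mod_cast hN0
  have hlog : 1 ≤ Real.log N := by
    rw [Real.le_log_iff_exp_le hN0']
    have h4 : (4 : ℝ) ≤ N := by exact_mod_cast hN4
    linarith [Real.exp_one_lt_d9]
  have hmix : ∀ α : Fin (d + 1) → ℕ, (∀ i, α i ≤ m) →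
      HasMixedDerivs (cubeBoundary (d + 1)) α (transformed ω ψ h) := fun α hα =>
    (hψm.comp_mapCube hm (fun j => (hψ j).mapsTo) hhm hα).mul (hsm.hasMixedDerivs hα)
  have hmix0 := hmix 0 fun _ => Nat.zero_le _
  obtain ⟨F, hF⟩ := exists_torus_lift hmix0.continuousOn hmix0.eq_zero
  have hcoef : ∀ k, UnitAddTorus.mFourierCoeff F k = fourierCoef ω ψ h k := fun k => by
    rw [mFourierCoeff_eq_cubeCoef hF, fourierCoef_eq_cubeCoef hω hψ]
  have hsum : Summable fun k : Fin (d + 1) → ℤ =>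
      (hcWeight k : ℝ) ^ (2 * m) * ‖fourierCoef ω ψ h k‖ ^ 2 := by
    simp_rw [fourierCoef_eq_cubeCoef hω hψ]
    exact summable_hcWeight_mul_cubeCoef hmix
  have hs : ContinuousOn (sqrtWeight ω ψ) (cube (d + 1)) := by
    obtain ⟨D, hD, hD'⟩ := hsm
    exact (hD' 0 fun _ => Nat.zero_le _).1.congr fun x hx => (hD.zero x hx).symm
  have herr := weighted_error_le hω hψ hs hmix0.continuousOn (hyperbolicCross (d + 1) N)
    (latticeCoef ω ψ z M h)
  refine ⟨⟨hh, hsum⟩, herr.1, ?_⟩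
  have htorus := integral_norm_sub_lattice_sq_le z hm hM hN0 hlog hrec F
    (by simpa only [hcoef] using hsum)
  rw [integral_torus_eq_integral_cube, MeasureTheory.setIntegral_congr_fun measurableSet_cube
    (g := fun x => ‖transformed ω ψ h x - ∑ k ∈ hyperbolicCross (d + 1) N,
      latticeCoef ω ψ z M h k * character k x‖ ^ 2) (fun x hx => by
        simp only [hF x hx, latticeCoef_eq_torusLatticeCoef hψ hω z M hF, character])] at htorus
  simp_rw [hcoef] at htorus
  rw [weightedNorm, normH]
  refine (Real.sqrt_le_sqrt (herr.2.trans htorus)).trans (le_of_eq ?_)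
  have hlog0 : 0 ≤ Real.log N := zero_le_one.trans hlog
  rw [← hK, Real.sqrt_mul (by positivity), Real.sqrt_div (by positivity), Real.sqrt_mul hK0.le,
    mul_comm 2 m, pow_mul, Real.sqrt_sq (by positivity), zpow_neg, zpow_natCast]
  have hpow : √(Real.log N ^ d) = Real.log N ^ ((((d + 1 : ℕ) : ℝ) - 1) / 2) := by
    rw [Real.sqrt_eq_rpow, ← Real.rpow_natCast, ← Real.rpow_mul hlog0]
    congr 1
    push_cast
    ring
  rw [hpow]
  ring
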